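/- Let $n\ge 1$ be an integer. For positive integers $a,b,c$, the $(a,b,c)$ hexagon is the hexagon with all angles equal to $120^\circ$ and with sides of lengths $a,b,c,a,b,c$ in clockwise order, drawn so that the second side (of length $b$) is the horizontal top side. It is subdivided into equilateral triangles of unit side by lines parallel to its sides. A lozenge is the union of two of these unit triangles that share an edge, and a lozenge tiling of the hexagon is a set of lozenges such that every unit triangle of the hexagon is covered by exactly one of them. In a $(2n-1,2n,2n-1)$ hexagon, and likewise in a $(2n,2n-1,2n)$ hexagon, the center of the hexagon is the midpoint of a horizontal edge of the subdivision; the two unit triangles that share this edge are called the two central triangles. **Theorem.** In the $(2n-1,2n,2n-1)$ hexagon, and also in the $(2n,2n-1,2n)$ hexagon, the two central triangles are covered by a single lozenge in exactly one third of all lozenge tilings. -/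

import Mathlib

/-!
Points of the triangular lattice are written as integer pairs `(x, y)`, standing for the point
`x • e₁ + y • e₂` of the plane, where `e₁ = (1, 0)` and `e₂ = (1/2, √3/2)` are unit vectors at an
angle of 60 degrees. The six lattice neighbours of a point are obtained by adding one of
`±e₁`, `±e₂`, `±(e₂ - e₁)`.
-/

namespace LozengeTilings

/-- A unit triangle of the triangular lattice.
`up x y` is the upward pointing triangle whose lower left vertex is `(x, y)`;
`down x y` is the downward pointing triangle whose upper right vertex is `(x + 1, y + 1)`. -/
inductive Triangle where
  | up (x y : ℤ)
  | down (x y : ℤ)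
  deriving DecidableEq

/-- The three vertices of a unit triangle, in lattice coordinates. -/
def Triangle.vertices : Triangle → Finset (ℤ × ℤ)
  | .up x y => {(x, y), (x + 1, y), (x, y + 1)}
  | .down x y => {(x + 1, y), (x, y + 1), (x + 1, y + 1)}

/-- The lattice points of the `(a, b, c)` hexagon (boundary included), placed with its lower left
corner at the origin. Clockwise, starting with the lower end of the upper left side, its corners are
`(-c, c)`, `(-c, a + c)`, `(b - c, a + c)`, `(b, a)`, `(b, 0)`, `(0, 0)`,
so that its sides are, clockwise, `a` (upper left), `b` (top), `c` (upper right), `a` (lower right),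
`b` (bottom) and `c` (lower left), and all its angles are 120 degrees. Each of the three pairs of
inequalities describes the strip between two parallel sides. -/
def hexagonPoints (a b c : ℕ) : Set (ℤ × ℤ) :=
  {p | (0 ≤ p.2 ∧ p.2 ≤ a + c) ∧ (-c ≤ p.1 ∧ p.1 ≤ b) ∧ (0 ≤ p.1 + p.2 ∧ p.1 + p.2 ≤ a + b)}

/-- The unit triangles into which the `(a, b, c)` hexagon is subdivided. -/
def hexagon (a b c : ℕ) : Set Triangle :=
  {t | ∀ p ∈ t.vertices, p ∈ hexagonPoints a b c}

/-- A lozenge, recorded as the set of the two unit triangles that it covers: two distinct unit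
triangles with a common edge (that is, with exactly two common vertices). -/
def IsLozenge (l : Finset Triangle) : Prop :=
  ∃ s t : Triangle, s ≠ t ∧ (s.vertices ∩ t.vertices).card = 2 ∧ l = {s, t}

/-- A lozenge tiling of a region `R` made of unit triangles: a set of lozenges contained in `R`
such that every unit triangle of `R` is covered by exactly one of them. -/
def IsTiling (R : Set Triangle) (T : Set (Finset Triangle)) : Prop :=
  (∀ l ∈ T, IsLozenge l ∧ ∀ t ∈ l, t ∈ R) ∧ ∀ t ∈ R, ∃! l, l ∈ T ∧ t ∈ l

/-- The set of all lozenge tilings of the `(a, b, c)` hexagon. -/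
def hexagonTilings (a b c : ℕ) : Set (Set (Finset Triangle)) :=
  {T | IsTiling (hexagon a b c) T}

/-- The centre of the `(a, b, c)` hexagon (the common midpoint of its three long diagonals),
in lattice coordinates. -/
def hexagonCentre (a b c : ℕ) : ℚ × ℚ :=
  (((b : ℚ) - c) / 2, ((a : ℚ) + c) / 2)

/-- The closed triangular region of a unit triangle, in lattice coordinates. -/
def Triangle.region (t : Triangle) : Set (ℚ × ℚ) :=
  convexHull ℚ ((fun p : ℤ × ℤ => ((p.1 : ℚ), (p.2 : ℚ))) '' (t.vertices : Set (ℤ × ℤ)))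

/-- The central triangles of the `(a, b, c)` hexagon: its unit triangles that contain its centre.
If the centre is the midpoint of an edge of the subdivision, as in a `(k, q, k)` hexagon with
`k, q ≥ 1` and `k + q` odd, these are the two triangles that share this edge. -/
def centralTriangles (a b c : ℕ) : Set Triangle :=
  {t | t ∈ hexagon a b c ∧ hexagonCentre a b c ∈ t.region}

/-- The tilings of the `(a, b, c)` hexagon in which a single lozenge covers the central triangles
(and nothing else). -/
def centralTilings (a b c : ℕ) : Set (Set (Finset Triangle)) :=
  {T | T ∈ hexagonTilings a b c ∧ ∃ l ∈ T, (l : Set Triangle) = centralTriangles a b c}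

end LozengeTilings

/-! Both hexagons have sides `(k, b, k)` with `b + k = 2M + 1` and `M = 2n - 1`. Following the
lozenges that are not vertical upwards from the bottom side turns a tiling into `b` nonintersecting
lattice paths with `2k` steps (`bijOn_tilingPaths`). The central triangles form a vertical lozenge
exactly when no path passes through the central position at height `k` (`mem_centralTilings_iff`).

By Lindström–Gessel–Viennot (`ncard_pathFamilies`) all families are counted by `det (W Wᵀ)`, where
`W = pascalMatrix b k (2M + 1)` has entries `C(k, p - i)`; the families avoiding the centre are
counted by `det (W Wᵀ - v vᵀ)`, where `v` is the middle column of `W`. The quotient `1 - vᵀ (W Wᵀ)⁻¹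
v` is the middle diagonal entry of the orthogonal projection onto `ker W`
(`det_mul_transpose_sub_vecMulVec`). Up to alternating signs `W` takes `k`-th differences, so `ker
W` consists of the sign-alternated polynomials of degree less than `k` on `{0, …, 2M}`. The quotient
is thus the value at `(M, M)` of the reproducing kernel of these polynomials
(`ncard_centralTilings_div`).

In the orthogonal basis of discrete Chebyshev polynomials `T_j = cheb (2M) j`, that value is the sum
of `T_j(M)² / ‖T_j‖²` over `j < k`. Odd `j` contribute nothing, so `k = 2n - 1` and `k = 2n` give
the same sum; even `j` give a terminated very well poised series. Its value `1/3` follows by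
induction on `n` from a telescoping relation between the parameters `N` and `N + 2`
(`sum_wellPoisedTerm`). -/

namespace LozengeTilings

open Finset Matrix

/-! ### A very well poised sum -/

/-- The terms of the very well poised series
`₅F₄(1/2, 5/4, 1/2, (1 - N)/2, (1 + N)/2; 1/4, 1, 1 + N/2, 1 - N/2; 1) / N`. -/
def wellPoisedTerm (N : ℚ) : ℕ → ℚ
  | 0 => 1 / N
  | i + 1 => wellPoisedTerm N i * (((2 * i + 1) ^ 2 * (N + 2 * i + 1) * (N - 2 * i - 1) * (4 * i + 5)) /
      ((2 * i + 2) ^ 2 * (N - 2 * i - 2) * (N + 2 * i + 2) * (4 * i + 1)))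

theorem wellPoisedTerm_add_two (N : ℚ) (i : ℕ) (h : (2 * i : ℚ) < N) :
    wellPoisedTerm (N + 2) i =
      wellPoisedTerm N i * ((N + 1 + 2 * i) * (N - 2 * i) / ((N + 1 - 2 * i) * (N + 2 + 2 * i))) := by
  induction i with
  | zero =>
    have : 0 < N := by simpa using h
    simp only [wellPoisedTerm, Nat.cast_zero, mul_zero, add_zero, sub_zero]
    have h1 : N + 1 ≠ 0 := by linarith
    field_simp
  | succ i ih =>
    push_cast at h
    have hi : (0 : ℚ) ≤ i := by positivity
    rw [wellPoisedTerm, ih (by linarith), wellPoisedTerm]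
    push_cast
    have h1 : N + 1 - 2 * i ≠ 0 := by linarith
    have h2 : N + 2 + 2 * (i : ℚ) ≠ 0 := by linarith
    have h3 : N + 2 - 2 * i - 2 ≠ 0 := by linarith
    have h4 : N + 2 + 2 * (i : ℚ) + 2 ≠ 0 := by linarith
    have h5 : N - 2 * i - 2 ≠ 0 := by linarith
    have h6 : N + 2 * (i : ℚ) + 2 ≠ 0 := by linarith
    have h7 : N + 1 - 2 * (i + 1 : ℚ) ≠ 0 := by linarith
    have h8 : N + 2 + 2 * (i + 1 : ℚ) ≠ 0 := by linarith
    have h9 : 4 * (i : ℚ) + 1 ≠ 0 := by positivity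
    have h10 : 2 * (i : ℚ) + 2 ≠ 0 := by positivity
    rw [show N + 2 - 2 * i - 2 = N - 2 * i by ring, show N + 2 + 2 * (i : ℚ) + 2 = N + 2 * i + 4 by ring,
      show N + 2 - 2 * (i : ℚ) - 1 = N + 1 - 2 * i by ring,
      show N + 1 - 2 * (i + 1 : ℚ) = N - 2 * i - 1 by ring,
      show N + 2 + 2 * (i + 1 : ℚ) = N + 2 * i + 4 by ring,
      show N + 2 + 2 * (i : ℚ) = N + 2 * i + 2 by ring] at *
    have h11 : N - 2 * (i : ℚ) ≠ 0 := by linarith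
    field_simp
    ring

/-- The termwise differences telescope: the subtracted product is a closed form of their partial
sums, zero at `n = 0` because of the factor `n ^ 2`. -/
theorem sum_wellPoisedTerm_add_two (N : ℚ) (n : ℕ) (h : (2 * n : ℚ) < N) :
    ∑ i ∈ range n, wellPoisedTerm (N + 2) i = ∑ i ∈ range n, wellPoisedTerm N i -
      2 / (N + 1) * (4 * n ^ 2 * (N - 2 * n) / ((4 * n + 1) * (N + 1 - 2 * n))) *
        wellPoisedTerm N n := by
  induction n with
  | zero => simp
  | succ n ih =>
    push_cast at h
    have hn : (0 : ℚ) ≤ n := by positivity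
    rw [sum_range_succ, sum_range_succ, ih (by linarith), wellPoisedTerm_add_two N n (by linarith),
      wellPoisedTerm]
    push_cast
    have h1 : N + 1 - 2 * n ≠ 0 := by linarith
    have h2 : N + 2 + 2 * (n : ℚ) ≠ 0 := by linarith
    have h3 : N + 1 ≠ 0 := by linarith
    have h6 : N + 2 * (n : ℚ) + 2 ≠ 0 := by linarith
    have h8 : N - 2 * (n : ℚ) - 1 ≠ 0 := by linarith
    have h9 : 4 * (n : ℚ) + 1 ≠ 0 := by positivity
    have h10 : 4 * (n : ℚ) + 5 ≠ 0 := by positivity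
    rw [show N + 1 - 2 * (n + 1 : ℚ) = N - 2 * n - 1 by ring,
      show N + 2 + 2 * (n : ℚ) = N + 2 * n + 2 by ring,
      show N - 2 * (n + 1 : ℚ) = N - 2 * n - 2 by ring,
      show 4 * (n + 1 : ℚ) + 1 = 4 * n + 5 by ring] at *
    have h5 : N - 2 * (n : ℚ) - 2 ≠ 0 := by linarith
    field_simp
    ring

/-- Passing from `n` to `n + 1` raises the parameter by 2 twice and adds one term. The two
telescoping corrections and the new term are all rational multiples of `wellPoisedTerm (4 * n - 1)
n`, and these multiples cancel. -/
theorem sum_wellPoisedTerm (n : ℕ) (hn : 1 ≤ n) :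
    ∑ i ∈ range n, wellPoisedTerm (4 * n - 1) i = 1 / 3 := by
  induction n, hn using Nat.le_induction with
  | base => norm_num [wellPoisedTerm]
  | succ n hn ih =>
    have hn' : (1 : ℚ) ≤ n := by exact_mod_cast hn
    have e : (4 * ((n + 1 : ℕ) : ℚ) - 1) = (4 * n - 1) + 2 + 2 := by push_cast; ring
    rw [sum_range_succ, e, sum_wellPoisedTerm_add_two _ n (by linarith),
      sum_wellPoisedTerm_add_two _ n (by linarith), ih,
      wellPoisedTerm_add_two (4 * n - 1 + 2) n (by linarith),
      wellPoisedTerm_add_two (4 * n - 1) n (by linarith)]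
    rw [show (4 * n - 1 + 2 + 1 - 2 * n : ℚ) = 2 * (n + 1) by ring,
      show (4 * n - 1 + 2 + 2 + 2 * n : ℚ) = 3 * (2 * n + 1) by ring,
      show (4 * n - 1 + 1 - 2 * n : ℚ) = 2 * n by ring,
      show (4 * n - 1 + 2 + 2 * n : ℚ) = 6 * n + 1 by ring,
      show (4 * n - 1 + 1 : ℚ) = 4 * n by ring,
      show (4 * n - 1 + 2 + 1 : ℚ) = 2 * (2 * n + 1) by ring]
    field_simp
    ring

/-! ### Discrete Chebyshev polynomials -/

/-- Coefficients of the discrete Chebyshev polynomials in the binomial basis. -/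
def chebCoeff (D j i : ℕ) : ℚ :=
  (-1) ^ i * (j + i).choose (2 * i) * (i.centralBinom / D.choose i)

theorem chebCoeff_eq_zero {D j i : ℕ} (h : j < i) : chebCoeff D j i = 0 := by
  simp [chebCoeff, Nat.choose_eq_zero_of_lt (show j + i < 2 * i by omega)]

theorem chebCoeff_self_ne_zero {D j : ℕ} (h : j ≤ D) : chebCoeff D j j ≠ 0 := by
  have h1 : ((D.choose j : ℕ) : ℚ) ≠ 0 := by exact_mod_cast (Nat.choose_pos h).ne'
  have h2 : ((j.centralBinom : ℕ) : ℚ) ≠ 0 := by exact_mod_cast j.centralBinom_ne_zero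
  simp [chebCoeff, ← two_mul, h1, h2]

/-- The discrete Chebyshev polynomial of degree `j`, orthogonal on `{0, …, D}`. -/
def cheb (D j y : ℕ) : ℚ := ∑ i ∈ range (D + 1), chebCoeff D j i * y.choose i

theorem cheb_zero (D y : ℕ) : cheb D 0 y = 1 := by
  rw [cheb, sum_range_succ', sum_eq_zero fun i _ => by rw [chebCoeff_eq_zero (by omega), zero_mul]]
  simp [chebCoeff]

theorem chebCoeff_recurrence_zero (D j : ℕ) :
    ((j + 1) * (D - j) * chebCoeff D (j + 1) 0 + j * (D + 1 + j) * chebCoeff D (j - 1) 0 : ℚ) =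
      (2 * j + 1) * (D * chebCoeff D j 0) := by
  simp [chebCoeff]; ring

/-- This is the coefficient of `C(y, l + 1)` in the three-term recurrence. Since `y C(y, i) = i C(y,
i) + (i + 1) C(y, i + 1)`, multiplication by `y` couples only `l` and `l + 1`. In the main case, the
proof expresses every binomial through a single one and compares rational functions. -/
theorem chebCoeff_recurrence_succ {D j l : ℕ} (hj : j + 1 ≤ D) (hl : l + 1 ≤ D) :
    ((j + 1) * (D - j) * chebCoeff D (j + 1) (l + 1) +
        j * (D + 1 + j) * chebCoeff D (j - 1) (l + 1) : ℚ) =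
      (2 * j + 1) * ((D - 2 * (l + 1)) * chebCoeff D j (l + 1) - 2 * (l + 1) * chebCoeff D j l) := by
  have hg : (l.centralBinom / D.choose l : ℚ) =
      (D - l) / (2 * (2 * l + 1)) * ((l + 1).centralBinom / D.choose (l + 1)) := by
    have h1 : ((l + 1) * (l + 1).centralBinom : ℚ) = 2 * (2 * l + 1) * l.centralBinom := by
      exact_mod_cast Nat.succ_mul_centralBinom_succ l
    have h2 : (D.choose (l + 1) * (l + 1) : ℚ) = D.choose l * (D - l) := by
      rw [← Nat.cast_sub (by omega)]
      exact_mod_cast Nat.choose_succ_right_eq D l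
    have h3 : ((D.choose l : ℕ) : ℚ) ≠ 0 := by exact_mod_cast (Nat.choose_pos (by omega)).ne'
    have h4 : ((D.choose (l + 1) : ℕ) : ℚ) ≠ 0 := by exact_mod_cast (Nat.choose_pos hl).ne'
    field_simp
    linear_combination ((l + 1).centralBinom : ℚ) * h2 - D.choose (l + 1) * h1
  have key : ∀ m : ℕ, ((m.choose (2 * l + 1)) * (2 * l + 1) : ℚ) = m.choose (2 * l) * (m - 2 * l) ∧
      ((m.choose (2 * l + 2)) * (2 * l + 2) : ℚ) = m.choose (2 * l + 1) * (m - (2 * l + 1)) := by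
    intro m
    have aux : ∀ r : ℕ, ((m.choose (r + 1)) * (r + 1) : ℚ) = m.choose r * (m - r) := by
      intro r
      rcases le_or_gt r m with h | h
      · rw [← Nat.cast_sub h]; exact_mod_cast Nat.choose_succ_right_eq m r
      · simp [Nat.choose_eq_zero_of_lt h, Nat.choose_eq_zero_of_lt (show m < r + 1 by omega)]
    have a1 := aux (2 * l)
    have a2 := aux (2 * l + 1)
    push_cast at a1 a2
    exact ⟨a1, by linear_combination a2⟩
  set g : ℚ := (l + 1).centralBinom / D.choose (l + 1) with hgdef
  have h6 : (2 * l + 1 : ℚ) ≠ 0 := by positivity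
  rcases j with _ | j
  · rcases l with _ | l
    · simp only [chebCoeff, hg]
      have h2 : Nat.centralBinom 1 = 2 := rfl
      norm_num [hgdef, h2]
      ring
    · simp only [chebCoeff_eq_zero (show 0 + 1 < l + 1 + 1 by omega),
        chebCoeff_eq_zero (show 0 < l + 1 + 1 by omega), chebCoeff_eq_zero (show 0 < l + 1 by omega)]
      simp
  · simp only [chebCoeff, hg, ← hgdef, Nat.add_sub_cancel]
    obtain ⟨k1, k2⟩ := key (j + l + 1)
    rw [show j + 1 + 1 + (l + 1) = j + l + 1 + 1 + 1 by ring, show 2 * (l + 1) = 2 * l + 1 + 1 by ring,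
      show j + 1 + (l + 1) = j + l + 1 + 1 by ring, show j + (l + 1) = j + l + 1 by ring,
      show j + 1 + l = j + l + 1 by ring]
    simp only [Nat.choose_succ_succ' (j + l + 1 + 1), Nat.choose_succ_succ' (j + l + 1) (2 * l + 1),
      Nat.choose_succ_succ' (j + l + 1) (2 * l)]
    push_cast at k1 k2 ⊢
    set A : ℚ := (((j + l + 1).choose (2 * l) : ℕ) : ℚ)
    have e1 : (((j + l + 1).choose (2 * l + 1) : ℕ) : ℚ) = A * (j + 1 - l) / (2 * l + 1) := by
      field_simp; linear_combination k1
    have e2 : (((j + l + 1).choose (2 * l + 1 + 1) : ℕ) : ℚ) =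
        A * (j + 1 - l) / (2 * l + 1) * (j - l) / (2 * l + 2) := by
      rw [← e1]; field_simp; linear_combination k2
    rw [e2, e1, pow_succ]
    have h7 : (2 * l + 2 : ℚ) ≠ 0 := by positivity
    field_simp
    ring

/-- At `j = 0` the truncated index `j - 1` is harmless, because its coefficient vanishes. -/
theorem cheb_recurrence {D j : ℕ} (hj : j + 1 ≤ D) (y : ℕ) :
    ((j + 1) * (D - j) * cheb D (j + 1) y + j * (D + 1 + j) * cheb D (j - 1) y : ℚ) =
      (2 * j + 1) * ((D - 2 * y) * cheb D j y) := by
  have hy : ∀ i : ℕ, (y * y.choose i : ℚ) = i * y.choose i + (i + 1) * y.choose (i + 1) := by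
    intro i
    rcases le_or_gt i y with h | h
    · have : (y.choose (i + 1) * (i + 1) : ℚ) = y.choose i * (y - i) := by
        rw [← Nat.cast_sub h]; exact_mod_cast Nat.choose_succ_right_eq y i
      linear_combination -this
    · simp [Nat.choose_eq_zero_of_lt h, Nat.choose_eq_zero_of_lt (show y < i + 1 by omega)]
  have shift : ∑ i ∈ range (D + 1), chebCoeff D j i * ((i + 1) * y.choose (i + 1)) =
      ∑ i ∈ range D, chebCoeff D j i * ((i + 1) * y.choose (i + 1)) := by
    rw [sum_range_succ, chebCoeff_eq_zero (by omega), zero_mul, add_zero]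
  have hX : (D - 2 * y) * cheb D j y = D * chebCoeff D j 0 + ∑ i ∈ range D,
      ((D - 2 * (i + 1)) * chebCoeff D j (i + 1) - 2 * (i + 1) * chebCoeff D j i) *
        y.choose (i + 1) := by
    have : (D - 2 * y) * cheb D j y = ∑ i ∈ range (D + 1), (D - 2 * i) * chebCoeff D j i * y.choose i
        - 2 * ∑ i ∈ range (D + 1), chebCoeff D j i * ((i + 1) * y.choose (i + 1)) := by
      rw [cheb, mul_sum, mul_sum, ← sum_sub_distrib]
      refine sum_congr rfl fun i _ => ?_
      linear_combination (-2 * chebCoeff D j i) * hy i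
    rw [this, shift, sum_range_succ', mul_sum, add_sub_right_comm, ← sum_sub_distrib, add_comm]
    congr 1
    · simp
    · refine sum_congr rfl fun i _ => ?_
      push_cast; ring
  rw [hX, cheb, cheb, mul_sum, mul_sum, ← sum_add_distrib, sum_range_succ',
    mul_add (2 * j + 1 : ℚ) (D * chebCoeff D j 0), mul_sum, add_comm ((2 * j + 1 : ℚ) * _)]
  congr 1
  · refine sum_congr rfl fun i hi => ?_
    have := chebCoeff_recurrence_succ hj (show i + 1 ≤ D by simp at hi; omega)
    linear_combination (y.choose (i + 1) : ℚ) * this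
  · have := chebCoeff_recurrence_zero D j
    simp only [Nat.choose_zero_right]
    push_cast
    linear_combination this

/-- A telescoping sum. Its closed form vanishes once `m > j`, which yields the orthogonality of
`T_j` to the constants. -/
theorem sum_choose_mul_centralBinom (j m : ℕ) :
    j * (j + 1) * ∑ i ∈ range m, ((-1) ^ i * (j + i).choose (2 * i) * i.centralBinom / (i + 1) : ℚ) =
      -(m * (m + 1)) * ((-1) ^ m * (j + m).choose (2 * m) * m.centralBinom / (m + 1)) := by
  induction m with
  | zero => simp
  | succ m ih =>
    rw [sum_range_succ, mul_add, ih, ← add_assoc, show 2 * (m + 1) = 2 * m + 1 + 1 by ring]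
    have h1 : ((m + 1) * (m + 1).centralBinom : ℚ) = 2 * (2 * m + 1) * m.centralBinom := by
      exact_mod_cast Nat.succ_mul_centralBinom_succ m
    have h2 : ((j + m + 1) * (j + m).choose (2 * m + 1) : ℚ) =
        (j + m + 1).choose (2 * m + 1 + 1) * (2 * m + 2) := by
      exact_mod_cast Nat.add_one_mul_choose_eq (j + m) (2 * m + 1)
    have h3 : ((j + m).choose (2 * m + 1) * (2 * m + 1) : ℚ) = (j + m).choose (2 * m) * (j - m) := by
      rcases le_or_gt m j with h | h
      · rw [← Nat.cast_sub h, show j - m = j + m - 2 * m by omega]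
        exact_mod_cast Nat.choose_succ_right_eq (j + m) (2 * m)
      · simp [Nat.choose_eq_zero_of_lt (show j + m < 2 * m by omega),
          Nat.choose_eq_zero_of_lt (show j + m < 2 * m + 1 by omega)]
    have e1 : (((m + 1).centralBinom : ℕ) : ℚ) = 2 * (2 * m + 1) * m.centralBinom / (m + 1) := by
      field_simp; linear_combination h1
    have e3 : (((j + m).choose (2 * m + 1) : ℕ) : ℚ) =
        (j + m).choose (2 * m) * (j - m) / (2 * m + 1) := by
      field_simp; linear_combination h3
    have e2 : (((j + m + 1).choose (2 * m + 1 + 1) : ℕ) : ℚ) =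
        (j + m + 1) * ((j + m).choose (2 * m) * (j - m) / (2 * m + 1)) / (2 * (m + 1)) := by
      rw [← e3]; field_simp; linear_combination -h2
    rw [e1, e2, pow_succ]
    push_cast
    field_simp
    ring

theorem sum_cheb {D j : ℕ} (hj : 1 ≤ j) (hjD : j ≤ D) : ∑ y ∈ range (D + 1), cheb D j y = 0 := by
  have hs : ∀ i : ℕ, ∑ y ∈ range (D + 1), (y.choose i : ℚ) = (D + 1).choose (i + 1) := by
    intro i
    generalize D + 1 = n
    induction n with
    | zero => simp
    | succ n ih => rw [sum_range_succ, ih, Nat.choose_succ_succ' n i]; push_cast; ring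
  simp only [cheb]
  rw [sum_comm]
  have key : ∀ i ∈ range (D + 1), ∑ y ∈ range (D + 1), chebCoeff D j i * (y.choose i : ℚ) =
      (D + 1) * ((-1) ^ i * (j + i).choose (2 * i) * i.centralBinom / (i + 1)) := by
    intro i hi
    have h1 : ((D.choose i : ℕ) : ℚ) ≠ 0 := by
      exact_mod_cast (Nat.choose_pos (by simp at hi; omega)).ne'
    have h2 : ((D + 1) * D.choose i : ℚ) = (D + 1).choose (i + 1) * (i + 1) := by
      exact_mod_cast Nat.add_one_mul_choose_eq D i
    have e2 : (((D + 1).choose (i + 1) : ℕ) : ℚ) = (D + 1) * D.choose i / (i + 1) := by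
      field_simp; linear_combination -h2
    rw [← mul_sum, hs, e2, chebCoeff]
    field_simp
  rw [sum_congr rfl key, ← mul_sum]
  have h := sum_choose_mul_centralBinom j (D + 1)
  rw [Nat.choose_eq_zero_of_lt (show j + (D + 1) < 2 * (D + 1) by omega)] at h
  have hj0 : (j : ℚ) * (j + 1) ≠ 0 := by positivity
  have := (mul_eq_zero.mp (h.trans (by simp))).resolve_left hj0
  rw [this, mul_zero]

theorem sum_mul_cheb_recurrence {D j : ℕ} (hj : j + 1 ≤ D) (f : ℕ → ℚ) :
    (2 * j + 1) * ∑ y ∈ range (D + 1), (D - 2 * y) * (f y * cheb D j y) =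
      (j + 1) * (D - j) * ∑ y ∈ range (D + 1), f y * cheb D (j + 1) y +
        j * (D + 1 + j) * ∑ y ∈ range (D + 1), f y * cheb D (j - 1) y := by
  simp only [mul_sum, ← sum_add_distrib]
  refine sum_congr rfl fun y _ => ?_
  linear_combination -f y * cheb_recurrence hj y

/-- Multiplication by `D - 2y` is self-adjoint. Pairing `(D - 2y) T_j` with `T_i` gives zero by
induction, because `i < j - 1`; moving the factor to `T_i` leaves a nonzero multiple of the pairing
of `T_j` with `T_{i+1}`. The bound on `i + j` is preserved when `i` drops and `j` rises by one. -/
theorem sum_cheb_mul_cheb {D i j : ℕ} (hij : i < j) (hD : i + j ≤ D) :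
    ∑ y ∈ range (D + 1), cheb D i y * cheb D j y = 0 := by
  induction i using Nat.strong_induction_on generalizing j with
  | _ i ih =>
  rcases i with _ | i
  · simp only [cheb_zero, one_mul]
    exact sum_cheb (by omega) (by omega)
  · have h1 := sum_mul_cheb_recurrence (show j + 1 ≤ D by omega) (cheb D i)
    rw [ih i (by omega) (show i < j + 1 by omega) (by omega),
      ih i (by omega) (show i < j - 1 by omega) (by omega), mul_zero, mul_zero, add_zero] at h1
    have h2 := sum_mul_cheb_recurrence (show i + 1 ≤ D by omega) (cheb D j)
    have h3 : (i : ℚ) * (D + 1 + i) * ∑ y ∈ range (D + 1), cheb D j y * cheb D (i - 1) y = 0 := by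
      rcases i with _ | i
      · simp
      · simp only [mul_comm (cheb D j _)]
        rw [ih (i + 1 - 1) (by omega) (by omega) (by omega), mul_zero]
    rw [h3, add_zero] at h2
    simp only [mul_comm (cheb D j _)] at h2
    have h4 : (2 * j + 1 : ℚ) ≠ 0 := by positivity
    rw [(mul_eq_zero.mp h1).resolve_left h4, mul_zero] at h2
    have h5 : (i + 1 : ℚ) * (D - i) ≠ 0 := by
      have : (i + 1 + 1 : ℚ) ≤ D := by exact_mod_cast (show i + 1 + 1 ≤ D by omega)
      exact mul_ne_zero (by positivity) (by linarith)
    exact (mul_eq_zero.mp h2.symm).resolve_left h5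

/-- Two evaluations of the sum of `(D - 2y) T_j T_{j+1}`, with the recurrence applied to either
factor. -/
theorem sum_cheb_sq_succ {D j : ℕ} (hj : 2 * j + 2 ≤ D) :
    ((D - j) * (2 * j + 3) : ℚ) * ∑ y ∈ range (D + 1), cheb D (j + 1) y * cheb D (j + 1) y =
      (D + 2 + j) * (2 * j + 1) * ∑ y ∈ range (D + 1), cheb D j y * cheb D j y := by
  have h1 := sum_mul_cheb_recurrence (show j + 1 ≤ D by omega) (cheb D (j + 1))
  have h2 := sum_mul_cheb_recurrence (show j + 1 + 1 ≤ D by omega) (cheb D j)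
  rw [sum_cheb_mul_cheb (by omega) (by omega), mul_zero, zero_add] at h2
  have h3 : (j : ℚ) * (D + 1 + j) * ∑ y ∈ range (D + 1), cheb D (j + 1) y * cheb D (j - 1) y = 0 := by
    rcases j with _ | j
    · simp
    · simp only [mul_comm (cheb D (j + 1 + 1) _)]
      rw [sum_cheb_mul_cheb (by omega) (by omega), mul_zero]
  rw [h3, add_zero] at h1
  simp only [mul_comm (cheb D (j + 1) _) (cheb D j _)] at h1
  have hj0 : (j + 1 : ℚ) ≠ 0 := by positivity
  apply mul_left_cancel₀ hj0
  push_cast at h2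
  linear_combination (2 * j + 1 : ℚ) * h2 - (2 * j + 3 : ℚ) * h1

theorem sum_cheb_sq_ne_zero {D j : ℕ} (hj : 2 * j ≤ D) :
    ∑ y ∈ range (D + 1), cheb D j y * cheb D j y ≠ 0 := by
  induction j with
  | zero => simp only [cheb_zero, mul_one, sum_const, card_range]; simp; positivity
  | succ j ih =>
    intro h0
    have h := sum_cheb_sq_succ (show 2 * j + 2 ≤ D by omega)
    rw [h0, mul_zero] at h
    exact mul_ne_zero (by positivity) (ih (by omega)) h.symm

/-- At `y = M` the factor `D - 2y` is zero, so the recurrence links only indices of equal parity;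
for `j = 0` it forces `T_1(M) = 0`. -/
theorem cheb_odd_centre {M i : ℕ} (hi : 2 * i + 1 ≤ 2 * M) : cheb (2 * M) (2 * i + 1) M = 0 := by
  induction i with
  | zero =>
    have h := cheb_recurrence (show 0 + 1 ≤ 2 * M by omega) M
    have hM : (M : ℚ) ≠ 0 := by simp; omega
    simpa [hM] using h
  | succ i ih =>
    have h := cheb_recurrence (show 2 * i + 2 + 1 ≤ 2 * M by omega) M
    rw [show 2 * i + 2 - 1 = 2 * i + 1 by omega, ih (by omega)] at h
    push_cast at h
    rw [sub_self, zero_mul, mul_zero, mul_zero, add_zero] at h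
    have h5 : (2 * i + 2 + 1 : ℚ) ≤ 2 * M := by exact_mod_cast hi
    refine (mul_eq_zero.mp h).resolve_left (mul_ne_zero (by positivity) (by linarith))

/-- Both sides start at `1 / (2M + 1)` and have the same term ratio: the recurrence at the centre
relates values two degrees apart, and the norm formula is applied twice. -/
theorem cheb_even_centre_sq_div {M i : ℕ} (hi : 2 * i ≤ M) :
    cheb (2 * M) (2 * i) M ^ 2 /
      ∑ y ∈ range (2 * M + 1), cheb (2 * M) (2 * i) y * cheb (2 * M) (2 * i) y =
        wellPoisedTerm (2 * M + 1) i := by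
  induction i with
  | zero => simp [cheb_zero, wellPoisedTerm]
  | succ i ih =>
    have h := cheb_recurrence (show 2 * i + 1 + 1 ≤ 2 * M by omega) M
    rw [Nat.add_sub_cancel] at h
    have s1 := sum_cheb_sq_succ (show 2 * (2 * i) + 2 ≤ 2 * M by omega)
    have s2 := sum_cheb_sq_succ (show 2 * (2 * i + 1) + 2 ≤ 2 * M by omega)
    rw [wellPoisedTerm, ← ih (by omega), show 2 * (i + 1) = 2 * i + 1 + 1 by ring]
    have n0 := sum_cheb_sq_ne_zero (show 2 * (2 * i) ≤ 2 * M by omega)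
    push_cast at h s1 s2 ⊢
    have h5 : (2 * i + 2 : ℚ) ≤ M := by exact_mod_cast hi
    have hi0 : (0 : ℚ) ≤ i := by positivity
    rw [sub_self, zero_mul, mul_zero] at h
    have d1 : (2 * M - (2 * i + 1) : ℚ) ≠ 0 := by linarith
    have d2 : (2 * M - 2 * i : ℚ) ≠ 0 := by linarith
    have d4 : (M - i : ℚ) ≠ 0 := by linarith
    have d3 : (2 * M + 1 - 2 * i - 2 : ℚ) ≠ 0 := by linarith
    generalize cheb (2 * M) (2 * i + 1 + 1) M = a at *
    generalize cheb (2 * M) (2 * i) M = b at *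
    generalize ∑ y ∈ range (2 * M + 1), cheb (2 * M) (2 * i + 1 + 1) y * _ = u at *
    generalize ∑ y ∈ range (2 * M + 1), cheb (2 * M) (2 * i + 1) y * _ = v at *
    generalize ∑ y ∈ range (2 * M + 1), cheb (2 * M) (2 * i) y * _ = w at *
    have ea : a = -((2 * i + 1) * (2 * M + 1 + (2 * i + 1)) * b) /
        ((2 * i + 2) * (2 * M - (2 * i + 1))) := by
      field_simp; linear_combination h
    have ev : v = (2 * M + 2 + 2 * i) * (4 * i + 1) * w / ((2 * M - 2 * i) * (4 * i + 3)) := by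
      field_simp; linear_combination s1 / 2
    have eu : u = (2 * M + 3 + 2 * i) * (4 * i + 3) * v / ((2 * M - (2 * i + 1)) * (4 * i + 5)) := by
      field_simp; linear_combination s2
    rw [eu, ev, ea]
    rw [show (2 * M + 1 - 2 * i - 2 : ℚ) = 2 * M - (2 * i + 1) by ring,
      show (2 * M + 1 - 2 * i - 1 : ℚ) = 2 * M - 2 * i by ring] at *
    field_simp
    ring

/-! ### The reproducing kernel at the centre -/

/-- The reproducing kernel, at the centre of `{0, …, 2M}`, of the polynomials of degree less
than `k`. -/
def chebKernel (M k y : ℕ) : ℚ :=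
  ∑ j ∈ range k, cheb (2 * M) j y * (cheb (2 * M) j M /
    ∑ y ∈ range (2 * M + 1), cheb (2 * M) j y * cheb (2 * M) j y)

/-- Only the summand `j = l` survives by orthogonality, which applies because all degrees involved
are at most `M`. -/
theorem sum_chebKernel_mul_cheb {M k l : ℕ} (hk : k ≤ M + 1) (hl : l < k) :
    ∑ y ∈ range (2 * M + 1), chebKernel M k y * cheb (2 * M) l y = cheb (2 * M) l M := by
  simp only [chebKernel, sum_mul]
  rw [sum_comm, sum_eq_single l]
  · have h := sum_cheb_sq_ne_zero (show 2 * l ≤ 2 * M by omega)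
    simp only [mul_right_comm, ← sum_mul]
    exact mul_div_cancel₀ _ h
  · intro j hj hjl
    simp only [mul_right_comm, ← sum_mul]
    rw [mem_range] at hj
    rcases lt_or_gt_of_ne hjl with h | h
    · rw [sum_cheb_mul_cheb h (by omega), zero_mul]
    · simp only [mul_comm (cheb (2 * M) j _)]
      rw [sum_cheb_mul_cheb h (by omega), zero_mul]
  · intro h; simp at h; omega

/-- The change from the Chebyshev to the binomial basis is triangular with nonzero diagonal, so the
reproducing property transfers by induction on the degree. -/
theorem sum_chebKernel_mul_choose {M k l : ℕ} (hk : k ≤ M + 1) (hl : l < k) :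
    ∑ y ∈ range (2 * M + 1), chebKernel M k y * y.choose l = M.choose l := by
  induction l using Nat.strong_induction_on with
  | _ l ih =>
  have h := sum_chebKernel_mul_cheb hk hl
  have hT : ∀ y, cheb (2 * M) l y = ∑ i ∈ range l, chebCoeff (2 * M) l i * y.choose i +
      chebCoeff (2 * M) l l * y.choose l := by
    intro y
    rw [← sum_range_succ, cheb]
    symm
    apply sum_subset
    · intro i; simp; omega
    · intro i _ hi
      rw [chebCoeff_eq_zero (by simp at hi; omega), zero_mul]
  simp only [hT, mul_add, sum_add_distrib, mul_sum] at h
  rw [sum_comm] at h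
  have e : ∑ i ∈ range l, ∑ y ∈ range (2 * M + 1),
      chebKernel M k y * (chebCoeff (2 * M) l i * y.choose i) =
        ∑ i ∈ range l, chebCoeff (2 * M) l i * M.choose i := by
    refine sum_congr rfl fun i hi => ?_
    rw [mem_range] at hi
    rw [← ih i hi (by omega), mul_sum]
    exact sum_congr rfl fun y _ => by ring
  rw [e, add_right_inj] at h
  simp only [mul_left_comm (chebKernel M k _)] at h
  rw [← mul_sum] at h
  exact mul_left_cancel₀ (chebCoeff_self_ne_zero (by omega)) h

theorem chebKernel_two_mul_centre {M n : ℕ} (h : 2 * n ≤ M + 1) :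
    chebKernel M (2 * n) M = ∑ i ∈ range n, wellPoisedTerm (2 * M + 1) i := by
  induction n with
  | zero => simp [chebKernel]
  | succ n ih =>
    rw [sum_range_succ, ← ih (by omega), chebKernel, chebKernel, show 2 * (n + 1) = 2 * n + 1 + 1 by ring,
      sum_range_succ, sum_range_succ, cheb_odd_centre (by omega), zero_mul, add_zero,
      ← cheb_even_centre_sq_div (show 2 * n ≤ M by omega)]
    ring

/-- The two values of `k` differ by the term of odd degree `2n - 1`, which vanishes at the centre;
the series parameter is `2M + 1 = 4n - 1`. -/
theorem chebKernel_centre {n k : ℕ} (hn : 1 ≤ n) (hk : k = 2 * n - 1 ∨ k = 2 * n) :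
    chebKernel (2 * n - 1) k (2 * n - 1) = 1 / 3 := by
  have h : chebKernel (2 * n - 1) (2 * n) (2 * n - 1) = 1 / 3 := by
    have e : (2 * ((2 * n - 1 : ℕ) : ℚ) + 1) = 4 * n - 1 := by
      push_cast [show 1 ≤ 2 * n by omega]
      ring
    rw [chebKernel_two_mul_centre (by omega), ← sum_wellPoisedTerm n hn, e]
  rcases hk with rfl | rfl
  · rw [← h]
    obtain ⟨m, rfl⟩ : ∃ m, n = m + 1 := ⟨n - 1, by omega⟩
    rw [show 2 * (m + 1) - 1 = 2 * m + 1 by omega, show 2 * (m + 1) = 2 * m + 1 + 1 by ring,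
      chebKernel, chebKernel, sum_range_succ _ (2 * m + 1), cheb_odd_centre (by omega), zero_mul,
      add_zero]
  · exact h

/-! ### Pascal matrices and their null spaces -/

/-- Binomial coefficients with integral lower index, extended by zero. -/
def intChoose (m : ℕ) (z : ℤ) : ℚ := if 0 ≤ z then m.choose z.toNat else 0

theorem intChoose_natCast (m t : ℕ) : intChoose m t = m.choose t := by simp [intChoose]

theorem intChoose_of_neg {m : ℕ} {z : ℤ} (h : z < 0) : intChoose m z = 0 := by
  simp [intChoose, h]

theorem intChoose_of_lt {m : ℕ} {z : ℤ} (h : m < z) : intChoose m z = 0 := by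
  rw [intChoose, if_pos (by omega), Nat.choose_eq_zero_of_lt (by omega), Nat.cast_zero]

theorem intChoose_zero (z : ℤ) : intChoose 0 z = if z = 0 then 1 else 0 := by
  rcases lt_trichotomy z 0 with h | rfl | h
  · rw [intChoose_of_neg h, if_neg (by omega)]
  · simp [intChoose]
  · rw [intChoose_of_lt (by simpa using h), if_neg (by omega)]

theorem intChoose_succ (m : ℕ) (z : ℤ) :
    intChoose (m + 1) z = intChoose m z + intChoose m (z - 1) := by
  rcases lt_trichotomy z 0 with h | rfl | h
  · rw [intChoose_of_neg h, intChoose_of_neg h, intChoose_of_neg (by omega), add_zero]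
  · simp [intChoose]
  · obtain ⟨t, rfl⟩ : ∃ t : ℕ, z = t + 1 := ⟨(z - 1).toNat, by omega⟩
    rw [add_sub_cancel_right, show (t + 1 : ℤ) = ((t + 1 : ℕ) : ℤ) by push_cast; rfl,
      intChoose_natCast, intChoose_natCast, intChoose_natCast, Nat.choose_succ_succ' m t]
    push_cast; ring

theorem intChoose_symm (m : ℕ) (z : ℤ) : intChoose m (m - z) = intChoose m z := by
  rcases lt_or_ge z 0 with h | h
  · rw [intChoose_of_neg h, intChoose_of_lt (by omega)]
  rcases lt_or_ge (m : ℤ) z with h' | h'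
  · rw [intChoose_of_lt h', intChoose_of_neg (by omega)]
  · obtain ⟨t, rfl⟩ : ∃ t : ℕ, z = t := ⟨z.toNat, by omega⟩
    rw [show (m - t : ℤ) = ((m - t : ℕ) : ℤ) by omega, intChoose_natCast, intChoose_natCast,
      Nat.choose_symm (by omega)]

/-- The matrix whose rows are the translates of the `k`-th row of Pascal's triangle. -/
def pascalMatrix (b k N : ℕ) : Matrix (Fin b) (Fin N) ℚ :=
  Matrix.of fun i p => intChoose k ((p : ℤ) - i)

/-- Alternating signs turn a row of binomial coefficients into the coefficients of a `k`-th forward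
difference; `b + k = N` makes each row contain its full support. -/
theorem pascalMatrix_mulVec {b k N : ℕ} (h : b + k = N) (g : ℕ → ℚ) (i : Fin b) :
    (pascalMatrix b k N *ᵥ fun p => (-1) ^ (p : ℕ) * g p) i =
      (-1) ^ (k + i) * (fwdDiff 1)^[k] g i := by
  have h1 : (pascalMatrix b k N *ᵥ fun p => (-1) ^ (p : ℕ) * g p) i =
      ∑ p ∈ range N, intChoose k ((p : ℤ) - (i : ℕ)) * ((-1) ^ p * g p) :=
    Fin.sum_univ_eq_sum_range (fun p => intChoose k ((p : ℤ) - (i : ℕ)) * ((-1) ^ p * g p)) N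
  have h2 : ∑ p ∈ Ico (i : ℕ) (i + k + 1), intChoose k ((p : ℤ) - (i : ℕ)) * ((-1) ^ p * g p) =
      ∑ p ∈ range N, intChoose k ((p : ℤ) - (i : ℕ)) * ((-1) ^ p * g p) := by
    apply sum_subset
    · intro p; simp; omega
    · intro p _ hp
      simp only [mem_Ico, not_and_or, not_le, not_lt] at hp
      rcases hp with hp | hp
      · rw [intChoose_of_neg (by omega), zero_mul]
      · rw [intChoose_of_lt (by omega), zero_mul]
  rw [h1, ← h2, sum_Ico_eq_sum_range, fwdDiff_iter_eq_sum_shift, mul_sum,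
    show (i : ℕ) + k + 1 - i = k + 1 by omega]
  refine sum_congr rfl fun t ht => ?_
  rw [show ((i + t : ℕ) : ℤ) - (i : ℕ) = (t : ℕ) by push_cast; ring, intChoose_natCast]
  obtain ⟨s, rfl⟩ : ∃ s, k = t + s := ⟨k - t, by simp at ht; omega⟩
  have : ((-1) ^ s * (-1) ^ s : ℚ) = 1 := by simp [← mul_pow]
  simp only [zsmul_eq_mul, smul_eq_mul, mul_one, Nat.add_sub_cancel_left, pow_add]
  push_cast
  linear_combination (-((t + s).choose t * (-1) ^ (i : ℕ) * (-1) ^ t * g (i + t)) : ℚ) * this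

theorem fwdDiff_iter_natChoose {i k : ℕ} (h : i < k) :
    (fwdDiff 1)^[k] (fun y : ℕ => (y.choose i : ℚ)) = 0 := by
  induction k generalizing i with
  | zero => omega
  | succ k ih =>
    rw [Function.iterate_succ_apply]
    rcases i with _ | i
    · have : fwdDiff 1 (fun y : ℕ => (y.choose 0 : ℚ)) = (0 : ℕ → ℚ) := by
        ext; simp [fwdDiff]
      rw [this]
      ext y
      simp [fwdDiff_iter_eq_sum_shift]
    · have : fwdDiff 1 (fun y : ℕ => (y.choose (i + 1) : ℚ)) = fun y : ℕ => (y.choose i : ℚ) := by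
        ext y; simp [fwdDiff, Nat.choose_succ_succ' y i]
      rw [this, ih (by omega)]

theorem fwdDiff_iter_chebKernel (M k : ℕ) : (fwdDiff 1)^[k] (chebKernel M k) = 0 := by
  have e : chebKernel M k = ∑ j ∈ range k, ∑ i ∈ range (2 * M + 1),
      ((cheb (2 * M) j M / ∑ y ∈ range (2 * M + 1), cheb (2 * M) j y * cheb (2 * M) j y) *
        chebCoeff (2 * M) j i) • fun y : ℕ => (y.choose i : ℚ) := by
    ext y
    simp only [chebKernel, Finset.sum_apply, Pi.smul_apply, smul_eq_mul]
    refine sum_congr rfl fun j _ => ?_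
    rw [cheb, sum_mul]
    exact sum_congr rfl fun i _ => by ring
  rw [e]
  simp only [fwdDiff_iter_finsetSum, fwdDiff_iter_const_smul]
  refine sum_eq_zero fun j hj => sum_eq_zero fun i _ => ?_
  rw [mem_range] at hj
  rcases lt_or_ge j i with h | h
  · rw [chebCoeff_eq_zero h, mul_zero, zero_smul]
  · rw [fwdDiff_iter_natChoose (by omega), smul_zero]

/-- Newton's expansion at 0. An `i`-th difference at 0 with `k ≤ i ≤ p` only involves `k`-th
differences at points up to `i - k < b`, so it vanishes. -/
theorem eq_sum_choose_of_fwdDiff_iter_eq_zero {b k : ℕ} {g : ℕ → ℚ}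
    (h : ∀ i < b, (fwdDiff 1)^[k] g i = 0) {p : ℕ} (hp : p < b + k) :
    g p = ∑ i ∈ range k, p.choose i * (fwdDiff 1)^[i] g 0 := by
  have h1 := shift_eq_sum_fwdDiff_iter 1 g p 0
  simp only [smul_eq_mul, mul_one, zero_add, nsmul_eq_mul] at h1
  have h2 : ∀ i, k ≤ i → i ≤ p → (fwdDiff 1)^[i] g 0 = 0 := by
    intro i hki hip
    obtain ⟨t, rfl⟩ := Nat.exists_eq_add_of_le' hki
    rw [Function.iterate_add_apply, fwdDiff_iter_eq_sum_shift]
    refine sum_eq_zero fun s hs => ?_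
    rw [mem_range] at hs
    rw [h _ (by simp; omega), smul_zero]
  rw [h1]
  rcases le_or_gt k (p + 1) with hk | hk
  · symm
    apply sum_subset (range_subset_range.mpr hk)
    intro i hi hi'
    simp at hi hi'
    rw [h2 i hi' (by omega), mul_zero]
  · apply sum_subset (range_subset_range.mpr hk.le)
    intro i hi hi'
    simp at hi hi'
    rw [Nat.choose_eq_zero_of_lt (by omega), Nat.cast_zero, zero_mul]

/-- On the null space, `r p = (-1)^p g p` with `g` a polynomial of degree less than `k`, which the
kernel reproduces at `M`. The factor `(-1)^M` restores the sign of `r` at the centre. -/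
theorem dotProduct_chebKernel {b k M : ℕ} (hN : b + k = 2 * M + 1) (hk : k ≤ M + 1)
    {r : Fin (2 * M + 1) → ℚ} (hr : pascalMatrix b k (2 * M + 1) *ᵥ r = 0) :
    (fun p : Fin (2 * M + 1) => (-1) ^ (p : ℕ) * ((-1) ^ M * chebKernel M k p)) ⬝ᵥ r =
      r ⟨M, by omega⟩ := by
  set g : ℕ → ℚ := fun p => if h : p < 2 * M + 1 then (-1) ^ p * r ⟨p, h⟩ else 0 with hg
  have hrg : r = fun p : Fin (2 * M + 1) => (-1) ^ (p : ℕ) * g p := by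
    ext p
    simp only [hg, p.isLt, dif_pos, ← mul_assoc, ← mul_pow]
    simp
  have hz : ∀ i < b, (fwdDiff 1)^[k] g i = 0 := by
    intro i hi
    have := congrFun hr ⟨i, hi⟩
    rw [hrg, pascalMatrix_mulVec hN] at this
    simpa using this
  have hgp := fun p hp => eq_sum_choose_of_fwdDiff_iter_eq_zero hz (p := p) hp
  have key : ∑ p ∈ range (2 * M + 1), chebKernel M k p * g p = g M := by
    rw [hgp M (by omega)]
    calc _ = ∑ p ∈ range (2 * M + 1), ∑ i ∈ range k,
          (chebKernel M k p * p.choose i) * (fwdDiff 1)^[i] g 0 := by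
          refine sum_congr rfl fun p hp => ?_
          rw [hgp p (by simp at hp; omega), mul_sum]
          exact sum_congr rfl fun i _ => by ring
      _ = _ := by
          rw [sum_comm]
          refine sum_congr rfl fun i hi => ?_
          rw [← sum_mul, sum_chebKernel_mul_choose hk (by simpa using hi)]
  rw [hrg, dotProduct, Fin.sum_univ_eq_sum_range
    (fun p => (-1) ^ p * ((-1) ^ M * chebKernel M k p) * ((-1) ^ p * g p))]
  simp only
  rw [← key, mul_sum]
  refine sum_congr rfl fun p _ => ?_
  have : ((-1) ^ p * (-1) ^ p : ℚ) = 1 := by simp [← mul_pow]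
  linear_combination ((-1) ^ M * chebKernel M k p * g p) * this

/-! ### Rank-one corrections of a Gram determinant -/

theorem det_mul_transpose_sub_vecMulVec {m n : Type*} [Fintype m] [DecidableEq m] [Fintype n]
    [DecidableEq n] (W : Matrix m n ℚ) (hW : (W * Wᵀ).det ≠ 0) (c : n) (q : n → ℚ)
    (hq : W *ᵥ q = 0) (hrep : ∀ r, W *ᵥ r = 0 → q ⬝ᵥ r = r c) :
    (W * Wᵀ - vecMulVec (fun i => W i c) (fun i => W i c)).det = q c * (W * Wᵀ).det := by
  set v : m → ℚ := fun i => W i c with hv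
  set u := (W * Wᵀ)⁻¹ *ᵥ v with hu
  have hunit : IsUnit (W * Wᵀ).det := hW.isUnit
  have hv' : W *ᵥ Pi.single c 1 = v := by ext i; simp [hv]
  have hWu : W *ᵥ (Wᵀ *ᵥ u) = v := by
    rw [mulVec_mulVec, hu, mulVec_mulVec, mul_nonsing_inv _ hunit, one_mulVec]
  -- This vector is the orthogonal projection of the basis vector at `c` onto the null space. Its
  -- product with `q` is `q c`, because `q` is orthogonal to the row space; its entry at `c` is `1 -
  -- v ⬝ᵥ u`, the factor in the rank-one determinant formula.
  have h1 := hrep (Pi.single c 1 - Wᵀ *ᵥ u) (by rw [mulVec_sub, hv', hWu, sub_self])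
  have h2 : q ⬝ᵥ (Wᵀ *ᵥ u) = 0 := by
    rw [dotProduct_mulVec, vecMul_transpose, hq, zero_dotProduct]
  have h3 : (Wᵀ *ᵥ u) c = v ⬝ᵥ u := rfl
  rw [dotProduct_sub, h2, sub_zero, dotProduct_single, mul_one, Pi.sub_apply, Pi.single_eq_same,
    h3] at h1
  have h4 : W * Wᵀ - vecMulVec v v = (W * Wᵀ) * (1 - vecMulVec u v) := by
    rw [mul_sub, mul_one, mul_vecMulVec, hu, mulVec_mulVec, mul_nonsing_inv _ hunit, one_mulVec]
  rw [h4, det_mul, h1, mul_comm, vecMulVec_eq Unit, det_one_sub_mul_comm]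
  congr 1
  simp [dotProduct, Matrix.mul_apply]

theorem det_pascalMatrix_sub {b k M : ℕ} (hN : b + k = 2 * M + 1) (hk : k ≤ M + 1)
    (hdet : (pascalMatrix b k (2 * M + 1) * (pascalMatrix b k (2 * M + 1))ᵀ).det ≠ 0) :
    (pascalMatrix b k (2 * M + 1) * (pascalMatrix b k (2 * M + 1))ᵀ -
      vecMulVec (fun i : Fin b => intChoose k (M - i)) (fun i : Fin b => intChoose k (M - i))).det =
      chebKernel M k M * (pascalMatrix b k (2 * M + 1) * (pascalMatrix b k (2 * M + 1))ᵀ).det := by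
  have h := det_mul_transpose_sub_vecMulVec _ hdet ⟨M, by omega⟩
    (fun p : Fin (2 * M + 1) => (-1) ^ (p : ℕ) * ((-1) ^ M * chebKernel M k p)) ?_
    fun r hr => dotProduct_chebKernel hN hk hr
  · simpa [pascalMatrix, ← mul_assoc, ← mul_pow] using h
  · ext i
    rw [pascalMatrix_mulVec hN (fun p => (-1) ^ M * chebKernel M k p)]
    have : (fun p => (-1) ^ M * chebKernel M k p) = ((-1) ^ M : ℚ) • chebKernel M k := rfl
    rw [this, fwdDiff_iter_const_smul, fwdDiff_iter_chebKernel]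
    simp

/-! ### Nonintersecting paths and determinants -/

/-- Families of `b` nonintersecting lattice paths starting at `s` and reaching `e` after `m` steps,
each step being `0` or `-1`, whose positions `x` after `y ≥ 1` steps satisfy `A y x`. The family is
recorded by its positions after `y` steps, constant for `y ≥ m`. -/
def pathFamilies {b : ℕ} (A : ℕ → ℤ → Prop) (s : Fin b → ℤ) (m : ℕ) (e : Fin b → ℤ) :
    Set (ℕ → Fin b → ℤ) :=
  {p | p 0 = s ∧ (∀ y < m, ∀ i, p (y + 1) i = p y i ∨ p (y + 1) i = p y i - 1) ∧
    (∀ y ≤ m, StrictMono (p y)) ∧ (∀ y < m, ∀ i, A (y + 1) (p (y + 1) i)) ∧ ∀ y ≥ m, p y = e}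

open Classical in
/-- The number of single lattice paths from `a` to `z` with `m` steps, with positions allowed
by `A`. -/
noncomputable def pathCount (A : ℕ → ℤ → Prop) : ℕ → ℤ → ℤ → ℚ
  | 0, a, z => if a = z then 1 else 0
  | m + 1, a, z => if A (m + 1) z then pathCount A m a z + pathCount A m a (z + 1) else 0

theorem pathFamilies_zero {b : ℕ} (A : ℕ → ℤ → Prop) {s e : Fin b → ℤ} (hs : StrictMono s) :
    pathFamilies A s 0 e = if s = e then {fun _ => e} else ∅ := by
  ext p
  split_ifs with h
  · subst h
    simp only [pathFamilies, Set.mem_ofPred_eq, Set.mem_singleton_iff]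
    constructor
    · rintro ⟨_, _, _, _, h⟩
      ext y i
      rw [h y (Nat.zero_le y)]
    · rintro rfl
      simpa using hs
  · simp only [pathFamilies, Set.mem_ofPred_eq, Set.mem_empty_iff_false, iff_false]
    rintro ⟨h0, _, _, _, h1⟩
    exact h (h0.symm.trans (h1 0 le_rfl))

theorem pathFamilies_eq_empty_of_not_strictMono {b : ℕ} (A : ℕ → ℤ → Prop) (s : Fin b → ℤ) (m : ℕ)
    {e : Fin b → ℤ} (he : ¬ StrictMono e) : pathFamilies A s m e = ∅ := by
  ext p
  simp only [pathFamilies, Set.mem_ofPred_eq, Set.mem_empty_iff_false, iff_false]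
  rintro ⟨_, _, h2, _, h1⟩
  exact he (h1 m le_rfl ▸ h2 m le_rfl)

/-- Splitting by the last step: `t` is the set of paths that stay put; the others come from `e + 1`.
-/
theorem pathFamilies_succ {b : ℕ} (A : ℕ → ℤ → Prop) (s : Fin b → ℤ) (m : ℕ) {e : Fin b → ℤ}
    (he : StrictMono e) (hA : ∀ i, A (m + 1) (e i)) :
    pathFamilies A s (m + 1) e = ⋃ t : Finset (Fin b),
      (fun (p : ℕ → Fin b → ℤ) y => if y ≤ m then p y else e) ''
        pathFamilies A s m (t.piecewise e (e + 1)) := by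
  ext p
  simp only [Set.mem_iUnion, Set.mem_image]
  constructor
  · rintro ⟨h0, h1, h2, h3, h4⟩
    refine ⟨univ.filter fun i => p m i = e i, fun y => p (min y m), ⟨by simpa using h0, ?_, ?_, ?_, ?_⟩,
      ?_⟩
    · intro y hy i
      simp only [Nat.min_eq_left (show y ≤ m by omega), Nat.min_eq_left (show y + 1 ≤ m by omega)]
      exact h1 y (by omega) i
    · intro y hy
      simp only [Nat.min_eq_left hy]
      exact h2 y (by omega)
    · intro y hy i
      simp only [Nat.min_eq_left (show y + 1 ≤ m by omega)]
      exact h3 y (by omega) i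
    · intro y hy
      simp only [Nat.min_eq_right hy]
      ext i
      by_cases hi : p m i = e i
      · simp [Finset.piecewise, hi]
      · have := h1 m (by omega) i
        rw [h4 (m + 1) le_rfl] at this
        simp only [Finset.piecewise, mem_filter, mem_univ, true_and, hi, if_false, Pi.add_apply,
          Pi.one_apply]
        omega
    · ext y i
      by_cases hy : y ≤ m
      · simp [hy]
      · simp [hy, h4 y (by omega)]
  · rintro ⟨t, p, ⟨h0, h1, h2, h3, h4⟩, rfl⟩
    have hm : ∀ i, e i = p m i ∨ e i = p m i - 1 := by
      intro i
      rw [h4 m le_rfl]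
      by_cases hi : i ∈ t <;> simp [Finset.piecewise, hi]
    refine ⟨by simpa using h0, ?_, ?_, ?_, ?_⟩
    · intro y hy i
      rcases Nat.lt_succ_iff_lt_or_eq.mp hy with hy | rfl
      · simp only [show y ≤ m by omega, show y + 1 ≤ m by omega, if_true]
        exact h1 y hy i
      · simpa using hm i
    · intro y hy
      by_cases hy' : y ≤ m
      · simpa [hy'] using h2 y hy'
      · simpa [hy'] using he
    · intro y hy i
      rcases Nat.lt_succ_iff_lt_or_eq.mp hy with hy | rfl
      · simp only [show y + 1 ≤ m by omega, if_true]
        exact h3 y hy i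
      · simpa using hA i
    · intro y hy
      simp [show ¬ y ≤ m by omega]

theorem piecewise_add_one_injective {b : ℕ} (e : Fin b → ℤ) :
    Function.Injective fun t : Finset (Fin b) => t.piecewise e (e + 1) := by
  intro t t' h
  ext i
  have := congrFun h i
  by_cases hi : i ∈ t <;> by_cases hi' : i ∈ t' <;> simp [Finset.piecewise, hi, hi'] at this ⊢

theorem injOn_extend_pathFamilies {b : ℕ} (A : ℕ → ℤ → Prop) (s : Fin b → ℤ) (m : ℕ)
    (e e' : Fin b → ℤ) :
    Set.InjOn (fun (p : ℕ → Fin b → ℤ) y => if y ≤ m then p y else e) (pathFamilies A s m e') := by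
  rintro p ⟨-, -, -, -, hp⟩ q ⟨-, -, -, -, hq⟩ h
  ext y i
  by_cases hy : y ≤ m
  · have := congrFun (congrFun h y) i
    simpa [hy] using this
  · rw [hp y (by omega), hq y (by omega)]

theorem finite_pathFamilies {b : ℕ} (A : ℕ → ℤ → Prop) {s : Fin b → ℤ} (hs : StrictMono s) (m : ℕ)
    (e : Fin b → ℤ) : (pathFamilies A s m e).Finite := by
  induction m generalizing e with
  | zero => rw [pathFamilies_zero A hs]; split_ifs <;> simp
  | succ m ih =>
    by_cases he : StrictMono e
    · by_cases hA : ∀ i, A (m + 1) (e i)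
      · rw [pathFamilies_succ A s m he hA]
        exact Set.finite_iUnion fun t => (ih _).image _
      · refine Set.finite_empty.subset ?_
        rintro p ⟨-, -, -, h3, h4⟩
        exact (hA fun i => by rw [← h4 (m + 1) le_rfl]; exact h3 m (by omega) i).elim
    · rw [pathFamilies_eq_empty_of_not_strictMono A s _ he]
      exact Set.finite_empty

theorem ncard_pathFamilies_succ {b : ℕ} (A : ℕ → ℤ → Prop) {s : Fin b → ℤ} (hs : StrictMono s)
    (m : ℕ) {e : Fin b → ℤ} (he : StrictMono e) (hA : ∀ i, A (m + 1) (e i)) :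
    (pathFamilies A s (m + 1) e).ncard =
      ∑ t : Finset (Fin b), (pathFamilies A s m (t.piecewise e (e + 1))).ncard := by
  rw [pathFamilies_succ A s m he hA, Set.ncard_iUnion_of_finite, finsum_eq_sum_of_fintype]
  · exact sum_congr rfl fun t _ => (injOn_extend_pathFamilies A s m e _).ncard_image
  · exact fun t => (finite_pathFamilies A hs m _).image _
  · intro t t' htt'
    rw [Function.onFun, Set.disjoint_left]
    rintro _ ⟨p, hp, rfl⟩ ⟨q, hq, h⟩
    apply htt'
    apply piecewise_add_one_injective e
    have := congrFun h m
    simp only [le_refl, if_true] at this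
    rw [hp.2.2.2.2 m le_rfl, hq.2.2.2.2 m le_rfl] at this
    exact this.symm

theorem strictMono_eq_of_perm {b : ℕ} {s e : Fin b → ℤ} (hs : StrictMono s) (he : StrictMono e)
    (σ : Equiv.Perm (Fin b)) (h : ∀ i, s (σ i) = e i) : s = e := by
  refine (hs.range_inj he).mp ?_
  ext z
  constructor
  · rintro ⟨i, rfl⟩
    exact ⟨σ.symm i, by rw [← h, Equiv.apply_symm_apply]⟩
  · rintro ⟨i, rfl⟩
    exact ⟨σ i, h i⟩

/-- The Lindström–Gessel–Viennot lemma for the paths under consideration. -/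
theorem ncard_pathFamilies {b : ℕ} (A : ℕ → ℤ → Prop) {s : Fin b → ℤ} (hs : StrictMono s) (m : ℕ)
    {e : Fin b → ℤ} (he : Monotone e) :
    ((pathFamilies A s m e).ncard : ℚ) =
      (Matrix.of fun i j => pathCount A m (s i) (e j)).det := by
  by_cases he' : StrictMono e
  swap
  · rw [pathFamilies_eq_empty_of_not_strictMono A s m he', Set.ncard_empty, Nat.cast_zero]
    have : ¬ Function.Injective e := fun h => he' (he.strictMono_of_injective h)
    simp only [Function.Injective, not_forall] at this
    obtain ⟨i, j, hij, hne⟩ := this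
    exact (det_zero_of_column_eq hne fun k => by simp [hij]).symm
  -- Induction on the number of steps replaces the usual sign-reversing involution. Multilinearity
  -- in the columns splits the determinant according to the last steps, just as the families split.
  -- Since steps are `0` or `-1`, the previous endpoints remain weakly ordered; when two of them
  -- coincide there is no family and the determinant has equal columns.
  induction m generalizing e with
  | zero =>
    rw [pathFamilies_zero A hs]
    split_ifs with h
    · subst h
      have : (Matrix.of fun i j => pathCount A 0 (s i) (s j)) = 1 := by
        ext i j
        simp [pathCount, Matrix.one_apply, hs.injective.eq_iff]
      rw [this]; simp
    · rw [Set.ncard_empty, Nat.cast_zero, det_apply]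
      symm
      refine sum_eq_zero fun σ _ => ?_
      have : ∃ i, s (σ i) ≠ e i := by
        by_contra! hc
        exact h (strictMono_eq_of_perm hs he' σ hc)
      obtain ⟨i, hi⟩ := this
      rw [prod_eq_zero (mem_univ i) (by simp [pathCount, hi]), smul_zero]
  | succ m ih =>
    by_cases hA : ∀ i, A (m + 1) (e i)
    · have hdet : (Matrix.of fun i j => pathCount A (m + 1) (s i) (e j)).det =
          ∑ t : Finset (Fin b),
            (Matrix.of fun i j => pathCount A m (s i) (t.piecewise e (e + 1) j)).det := by
        rw [← det_transpose]
        have hsum : (Matrix.of fun i j => pathCount A (m + 1) (s i) (e j))ᵀ =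
            (fun j i => pathCount A m (s i) (e j)) + (fun j i => pathCount A m (s i) (e j + 1)) := by
          ext j i
          simp [pathCount, hA]
        rw [hsum]
        refine (detRowAlternating.toMultilinearMap.map_add_univ _ _).trans ?_
        refine sum_congr rfl fun t _ => ?_
        rw [← det_transpose]
        change det _ = det _
        congr 1
        ext j i
        by_cases hj : j ∈ t <;> simp [Finset.piecewise, hj]
      rw [ncard_pathFamilies_succ A hs m he' hA, hdet, Nat.cast_sum]
      refine sum_congr rfl fun t _ => ?_
      have hmono : Monotone (t.piecewise e (e + 1)) := by
        intro i j hij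
        rcases hij.eq_or_lt with rfl | hij
        · exact le_rfl
        · have := he' hij
          by_cases hi : i ∈ t <;> by_cases hj : j ∈ t <;> simp [Finset.piecewise, hi, hj] <;> omega
      by_cases hst : StrictMono (t.piecewise e (e + 1))
      · exact ih hmono hst
      · rw [pathFamilies_eq_empty_of_not_strictMono A s m hst, Set.ncard_empty, Nat.cast_zero]
        have : ¬ Function.Injective (t.piecewise e (e + 1)) :=
          fun h => hst (hmono.strictMono_of_injective h)
        simp only [Function.Injective, not_forall] at this
        obtain ⟨i, j, hij, hne⟩ := this
        exact (det_zero_of_column_eq hne fun k => by simp [hij]).symm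
    · have : pathFamilies A s (m + 1) e = ∅ := by
        rw [Set.eq_empty_iff_forall_notMem]
        rintro p ⟨-, -, -, h3, h4⟩
        exact hA fun i => by rw [← h4 (m + 1) le_rfl]; exact h3 m (by omega) i
      rw [this, Set.ncard_empty, Nat.cast_zero]
      push Not at hA
      obtain ⟨j, hj⟩ := hA
      exact (det_eq_zero_of_column_eq_zero j fun i => by simp [pathCount, hj]).symm

/-! ### Path counts for the hexagon -/

theorem pathCount_true (m : ℕ) (a z : ℤ) :
    pathCount (fun _ _ => True) m a z = intChoose m (a - z) := by
  induction m generalizing z with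
  | zero => simp [pathCount, intChoose_zero, sub_eq_zero]
  | succ m ih => simp [pathCount, ih, intChoose_succ m, sub_sub]

theorem pathCount_avoid_of_lt {k m : ℕ} (hm : m < k) (x a z : ℤ) :
    pathCount (fun y w => ¬ (y = k ∧ w = x)) m a z = intChoose m (a - z) := by
  induction m generalizing z with
  | zero => simp [pathCount, intChoose_zero, sub_eq_zero]
  | succ m ih =>
    rw [pathCount, if_pos (by omega), ih (by omega), ih (by omega), intChoose_succ m, sub_sub]

/-- The paths through the forbidden point are subtracted. The starting position is not tested, so
the forbidden height must be positive. -/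
theorem pathCount_avoid_add {k : ℕ} (hk : 1 ≤ k) (m : ℕ) (x a z : ℤ) :
    pathCount (fun y w => ¬ (y = k ∧ w = x)) (k + m) a z =
      intChoose (k + m) (a - z) - intChoose k (a - x) * intChoose m (x - z) := by
  induction m generalizing z with
  | zero =>
    obtain ⟨k, rfl⟩ := Nat.exists_eq_add_of_le' hk
    rw [add_zero, pathCount, pathCount_avoid_of_lt (by omega), pathCount_avoid_of_lt (by omega),
      intChoose_zero, ← sub_sub a z 1, ← intChoose_succ]
    by_cases h : z = x
    · simp [h]
    · simp [h, sub_eq_zero, Ne.symm h]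
  | succ m ih =>
    rw [← add_assoc, pathCount, if_pos (by omega), ih, ih, intChoose_succ, intChoose_succ m,
      ← sub_sub a z 1, ← sub_sub x z 1]
    ring

/-- Vandermonde's convolution, with a range that contains the support of the first factor. -/
theorem sum_intChoose_mul_intChoose {N k i : ℕ} (hN : i + k < N) (m : ℕ) (z : ℤ) :
    ∑ p ∈ range N, intChoose k (p - i) * intChoose m (p - z) = intChoose (k + m) (i + k - z) := by
  induction m generalizing z with
  | zero =>
    rw [add_zero, show (i + k - z : ℤ) = k - (z - i) by ring, intChoose_symm]
    simp only [intChoose_zero, sub_eq_zero]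
    rcases lt_or_ge z 0 with h | h
    · rw [intChoose_of_neg (by omega)]
      exact sum_eq_zero fun p _ => by rw [if_neg (by omega), mul_zero]
    obtain ⟨t, rfl⟩ : ∃ t : ℕ, z = t := ⟨z.toNat, by omega⟩
    rw [sum_eq_single t]
    · simp
    · intro p _ hp
      rw [if_neg (by omega), mul_zero]
    · intro ht
      rw [intChoose_of_lt (by simp at ht; omega), zero_mul]
  | succ m ih =>
    simp only [intChoose_succ m, mul_add, sum_add_distrib, sub_sub _ z 1, ih]
    rw [← add_assoc, intChoose_succ (k + m), sub_sub _ z 1]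

/-- The product cuts the paths at half height: column `p` stands for position `p - k` at height `k`.
The right-hand side is the path matrix with `2k` steps. -/
theorem pascalMatrix_mul_transpose {b k N : ℕ} (hN : b + k = N) :
    pascalMatrix b k N * (pascalMatrix b k N)ᵀ =
      Matrix.of fun i j : Fin b => intChoose (k + k) ((i : ℤ) - (j - k)) := by
  ext i j
  rw [Matrix.mul_apply]
  refine (Fin.sum_univ_eq_sum_range
    (fun p => intChoose k ((p : ℤ) - (i : ℕ)) * intChoose k ((p : ℤ) - (j : ℕ))) N).trans ?_
  rw [sum_intChoose_mul_intChoose (by omega), Matrix.of_apply]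
  congr 1; ring

theorem strictMono_natCast (b : ℕ) : StrictMono fun i : Fin b => (i : ℤ) := fun i j h => by
  simpa using h

theorem strictMono_natCast_sub (b : ℕ) (k : ℤ) : StrictMono fun i : Fin b => (i : ℤ) - k :=
  fun i j h => by simpa using h

theorem pathFamilies_hexagon_nonempty (b k : ℕ) :
    (pathFamilies (fun _ _ => True) (fun i : Fin b => (i : ℤ)) (k + k)
      fun i => (i : ℤ) - k).Nonempty := by
  refine ⟨fun y i => i - (min y k : ℕ), by simp, ?_, fun y _ => strictMono_natCast_sub b _, by simp, ?_⟩
  · intro y _ i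
    simp only
    omega
  · intro y hy
    simp only [Nat.min_eq_right (show k ≤ y by omega)]

theorem ncard_pathFamilies_avoid {b k M : ℕ} (hN : b + k = 2 * M + 1) (hk : k ≤ M + 1)
    (hk1 : 1 ≤ k) :
    ((pathFamilies (fun y w => ¬ (y = k ∧ w = M - k)) (fun i : Fin b => (i : ℤ)) (k + k)
      fun i => (i : ℤ) - k).ncard : ℚ) = chebKernel M k M *
      (pathFamilies (fun _ _ => True) (fun i : Fin b => (i : ℤ)) (k + k)
        fun i => (i : ℤ) - k).ncard := by
  have hT : ((pathFamilies (fun _ _ => True) (fun i : Fin b => (i : ℤ)) (k + k)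
      fun i => (i : ℤ) - k).ncard : ℚ) =
        (pascalMatrix b k (2 * M + 1) * (pascalMatrix b k (2 * M + 1))ᵀ).det := by
    rw [ncard_pathFamilies _ (strictMono_natCast b) _ (strictMono_natCast_sub b k).monotone,
      pascalMatrix_mul_transpose hN]
    simp only [pathCount_true]
  have h0 : ((pathFamilies (fun _ _ => True) (fun i : Fin b => (i : ℤ)) (k + k)
      fun i => (i : ℤ) - k).ncard : ℚ) ≠ 0 := by
    rw [Nat.cast_ne_zero, ← Nat.pos_iff_ne_zero,
      Set.ncard_pos (finite_pathFamilies _ (strictMono_natCast b) _ _)]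
    exact pathFamilies_hexagon_nonempty b k
  rw [hT] at h0 ⊢
  rw [← det_pascalMatrix_sub hN hk h0,
    ncard_pathFamilies _ (strictMono_natCast b) _ (strictMono_natCast_sub b k).monotone,
    pascalMatrix_mul_transpose hN]
  congr 1
  ext i j
  -- The number of paths from `i` to `j - k` through the centre is the product of the entries of
  -- column `M` in rows `i` and `j`, a rank-one correction.
  rw [Matrix.sub_apply, vecMulVec_apply, Matrix.of_apply, Matrix.of_apply, pathCount_avoid_add hk1,
    ← intChoose_symm k (M - (i : ℕ)),
    show (k - (M - (i : ℕ)) : ℤ) = (i : ℕ) - (M - k) by ring,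
    show (M - k - ((j : ℕ) - k) : ℤ) = M - (j : ℕ) by ring]

/-! ### Lozenges and unit triangles -/

/-- The lozenge with a vertical long diagonal whose upper triangle is the upward one at `(x, y)`. -/
def lozengeV (x y : ℤ) : Finset Triangle := {.up x y, .down x (y - 1)}

/-- The lozenge made of the upward triangle at `(x, y)` and its right neighbour. -/
def lozengeR (x y : ℤ) : Finset Triangle := {.up x y, .down x y}

/-- The lozenge made of the upward triangle at `(x, y)` and its left neighbour. -/
def lozengeL (x y : ℤ) : Finset Triangle := {.up x y, .down (x - 1) y}

@[simp] theorem up_mem_lozengeV {x y u v : ℤ} : .up x y ∈ lozengeV u v ↔ x = u ∧ y = v := by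
  simp [lozengeV]

@[simp] theorem up_mem_lozengeR {x y u v : ℤ} : .up x y ∈ lozengeR u v ↔ x = u ∧ y = v := by
  simp [lozengeR]

@[simp] theorem up_mem_lozengeL {x y u v : ℤ} : .up x y ∈ lozengeL u v ↔ x = u ∧ y = v := by
  simp [lozengeL]

@[simp] theorem down_mem_lozengeV {x y u v : ℤ} : .down x y ∈ lozengeV u v ↔ x = u ∧ y = v - 1 := by
  simp [lozengeV]

@[simp] theorem down_mem_lozengeR {x y u v : ℤ} : .down x y ∈ lozengeR u v ↔ x = u ∧ y = v := by
  simp [lozengeR]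

@[simp] theorem down_mem_lozengeL {x y u v : ℤ} : .down x y ∈ lozengeL u v ↔ x = u - 1 ∧ y = v := by
  simp [lozengeL]

theorem lozengeR_injective {x y u v : ℤ} (h : lozengeR x y = lozengeR u v) : x = u ∧ y = v := by
  have : Triangle.up x y ∈ lozengeR u v := h ▸ (by simp)
  simpa using this

theorem lozengeR_ne_lozengeL (x y u v : ℤ) : lozengeR x y ≠ lozengeL u v := by
  intro h
  have h1 : Triangle.up x y ∈ lozengeL u v := h ▸ (by simp)
  have h2 : Triangle.down x y ∈ lozengeL u v := h ▸ (by simp)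
  simp at h1 h2; omega

theorem lozengeR_ne_lozengeV (x y u v : ℤ) : lozengeR x y ≠ lozengeV u v := by
  intro h
  have h1 : Triangle.up x y ∈ lozengeV u v := h ▸ (by simp)
  have h2 : Triangle.down x y ∈ lozengeV u v := h ▸ (by simp)
  simp at h1 h2; omega

theorem lozengeL_ne_lozengeV (x y u v : ℤ) : lozengeL x y ≠ lozengeV u v := by
  intro h
  have h1 : Triangle.up x y ∈ lozengeV u v := h ▸ (by simp)
  have h2 : Triangle.down (x - 1) y ∈ lozengeV u v := h ▸ (by simp)
  simp at h1 h2; omega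

theorem card_vertices_inter_up_up {x y u v : ℤ} (h : Triangle.up x y ≠ .up u v) :
    (Triangle.vertices (.up x y) ∩ Triangle.vertices (.up u v)).card ≠ 2 := by
  intro hc
  obtain ⟨⟨a, b⟩, ha, ⟨c, d⟩, hb, hne⟩ := Finset.one_lt_card.mp (by omega :
    1 < (Triangle.vertices (.up x y) ∩ Triangle.vertices (.up u v)).card)
  simp only [Triangle.vertices, mem_inter, mem_insert, mem_singleton, Prod.mk.injEq, ne_eq,
    Triangle.up.injEq] at ha hb hne h
  omega

theorem card_vertices_inter_down_down {x y u v : ℤ} (h : Triangle.down x y ≠ .down u v) :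
    (Triangle.vertices (.down x y) ∩ Triangle.vertices (.down u v)).card ≠ 2 := by
  intro hc
  obtain ⟨⟨a, b⟩, ha, ⟨c, d⟩, hb, hne⟩ := Finset.one_lt_card.mp (by omega :
    1 < (Triangle.vertices (.down x y) ∩ Triangle.vertices (.down u v)).card)
  simp only [Triangle.vertices, mem_inter, mem_insert, mem_singleton, Prod.mk.injEq, ne_eq,
    Triangle.down.injEq] at ha hb hne h
  omega

theorem card_vertices_inter_up_down {x y u v : ℤ} :
    (Triangle.vertices (.up x y) ∩ Triangle.vertices (.down u v)).card = 2 ↔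
      (u = x ∧ v = y - 1) ∨ (u = x ∧ v = y) ∨ (u = x - 1 ∧ v = y) := by
  constructor
  · intro hc
    obtain ⟨⟨a, b⟩, ha, ⟨c, d⟩, hb, hne⟩ := Finset.one_lt_card.mp (by omega :
      1 < (Triangle.vertices (.up x y) ∩ Triangle.vertices (.down u v)).card)
    simp only [Triangle.vertices, mem_inter, mem_insert, mem_singleton, Prod.mk.injEq, ne_eq]
      at ha hb hne
    omega
  · rintro (⟨rfl, rfl⟩ | ⟨rfl, rfl⟩ | ⟨rfl, rfl⟩)
    · rw [show Triangle.vertices (.up u y) ∩ Triangle.vertices (.down u (y - 1)) =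
        {(u, y), (u + 1, y)} by
          ext ⟨a, b⟩
          simp only [Triangle.vertices, mem_inter, mem_insert, mem_singleton, Prod.mk.injEq]
          omega]
      exact card_pair (by simp)
    · rw [show Triangle.vertices (.up u v) ∩ Triangle.vertices (.down u v) =
        {(u + 1, v), (u, v + 1)} by
          ext ⟨a, b⟩
          simp only [Triangle.vertices, mem_inter, mem_insert, mem_singleton, Prod.mk.injEq]
          omega]
      exact card_pair (by simp)
    · rw [show Triangle.vertices (.up x v) ∩ Triangle.vertices (.down (x - 1) v) =
        {(x, v), (x, v + 1)} by
          ext ⟨a, b⟩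
          simp only [Triangle.vertices, mem_inter, mem_insert, mem_singleton, Prod.mk.injEq]
          omega]
      exact card_pair (by simp)

theorem isLozenge_iff {l : Finset Triangle} :
    IsLozenge l ↔ ∃ x y, l = lozengeV x y ∨ l = lozengeR x y ∨ l = lozengeL x y := by
  constructor
  · rintro ⟨s, t, hst, hc, rfl⟩
    rcases s with ⟨x, y⟩ | ⟨x, y⟩ <;> rcases t with ⟨u, v⟩ | ⟨u, v⟩
    · exact (card_vertices_inter_up_up hst hc).elim
    · rcases card_vertices_inter_up_down.mp hc with ⟨rfl, rfl⟩ | ⟨rfl, rfl⟩ | ⟨rfl, rfl⟩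
      · exact ⟨u, y, Or.inl rfl⟩
      · exact ⟨u, v, Or.inr (Or.inl rfl)⟩
      · exact ⟨x, v, Or.inr (Or.inr rfl)⟩
    · rw [inter_comm] at hc
      rw [pair_comm]
      rcases card_vertices_inter_up_down.mp hc with ⟨rfl, rfl⟩ | ⟨rfl, rfl⟩ | ⟨rfl, rfl⟩
      · exact ⟨x, v, Or.inl rfl⟩
      · exact ⟨x, y, Or.inr (Or.inl rfl)⟩
      · exact ⟨u, y, Or.inr (Or.inr rfl)⟩
    · exact (card_vertices_inter_down_down hst hc).elim
  · rintro ⟨x, y, rfl | rfl | rfl⟩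
    · exact ⟨.up x y, .down x (y - 1), by simp, card_vertices_inter_up_down.mpr (by simp), rfl⟩
    · exact ⟨.up x y, .down x y, by simp, card_vertices_inter_up_down.mpr (by simp), rfl⟩
    · exact ⟨.up x y, .down (x - 1) y, by simp, card_vertices_inter_up_down.mpr (by simp), rfl⟩

theorem up_mem_hexagon {k b : ℕ} {x y : ℤ} : .up x y ∈ hexagon k b k ↔
    0 ≤ y ∧ y < k + k ∧ -k ≤ x ∧ x < b ∧ 0 ≤ x + y ∧ x + y < k + b := by
  simp only [hexagon, hexagonPoints, Triangle.vertices, Set.mem_ofPred_eq, mem_insert,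
    mem_singleton, forall_eq_or_imp, forall_eq]
  omega

theorem down_mem_hexagon {k b : ℕ} {x y : ℤ} : .down x y ∈ hexagon k b k ↔
    0 ≤ y ∧ y < k + k ∧ -k ≤ x ∧ x < b ∧ -1 ≤ x + y ∧ x + y + 1 < k + b := by
  simp only [hexagon, hexagonPoints, Triangle.vertices, Set.mem_ofPred_eq, mem_insert,
    mem_singleton, forall_eq_or_imp, forall_eq]
  omega

section Tiling

variable {R : Set Triangle} {T : Set (Finset Triangle)}

theorem IsTiling.eq_of_mem (hT : IsTiling R T) {l l' : Finset Triangle} (hl : l ∈ T) (hl' : l' ∈ T)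
    {t : Triangle} (ht : t ∈ l) (ht' : t ∈ l') : l = l' :=
  (hT.2 t ((hT.1 l hl).2 t ht)).unique ⟨hl, ht⟩ ⟨hl', ht'⟩

/-- An upward triangle of a lozenge in `T'` is covered by some lozenge of `T`, which also lies in
`T'` and so is the same one. One inclusion therefore suffices to recover a tiling from its paths. -/
theorem IsTiling.eq_of_subset {T' : Set (Finset Triangle)} (hT : IsTiling R T) (hT' : IsTiling R T')
    (h : T ⊆ T') : T = T' := by
  refine h.antisymm fun l hl => ?_
  obtain ⟨x, y, hxy⟩ := isLozenge_iff.mp (hT'.1 l hl).1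
  have hu : Triangle.up x y ∈ l := by rcases hxy with rfl | rfl | rfl <;> simp
  obtain ⟨l', ⟨hl', hu'⟩, -⟩ := hT.2 _ ((hT'.1 l hl).2 _ hu)
  rwa [hT'.eq_of_mem hl (h hl') hu hu']

theorem IsTiling.up_cases (hT : IsTiling R T) {x y : ℤ} (h : .up x y ∈ R) :
    lozengeV x y ∈ T ∨ lozengeR x y ∈ T ∨ lozengeL x y ∈ T := by
  obtain ⟨l, ⟨hl, hu⟩, -⟩ := hT.2 _ h
  obtain ⟨u, v, rfl | rfl | rfl⟩ := isLozenge_iff.mp (hT.1 l hl).1 <;> simp at hu <;>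
    obtain ⟨rfl, rfl⟩ := hu <;> simp [hl]

theorem IsTiling.down_cases (hT : IsTiling R T) {x y : ℤ} (h : .down x y ∈ R) :
    lozengeV x (y + 1) ∈ T ∨ lozengeR x y ∈ T ∨ lozengeL (x + 1) y ∈ T := by
  obtain ⟨l, ⟨hl, hu⟩, -⟩ := hT.2 _ h
  obtain ⟨u, v, rfl | rfl | rfl⟩ := isLozenge_iff.mp (hT.1 l hl).1 <;> simp at hu <;>
    obtain ⟨rfl, rfl⟩ := hu <;> simp [hl]

end Tiling

/-! ### From tilings to path families -/

open Classical in
/-- The position at height `y + 1` of the path of lozenges of `T` which at height `y` is at `x`. -/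
noncomputable def stepPosition (T : Set (Finset Triangle)) (y : ℕ) (x : ℤ) : ℤ :=
  if lozengeR x y ∈ T then x else x - 1

/-- The paths of lozenges of a tiling that start at the bottom side of the hexagon. -/
noncomputable def tilingPaths (k b : ℕ) (T : Set (Finset Triangle)) : ℕ → Fin b → ℤ
  | 0, i => i
  | y + 1, i => if y < k + k then stepPosition T y (tilingPaths k b T y i) else tilingPaths k b T y i

/-- The tiling of the hexagon given by a family of paths. -/
def familyTiling {b : ℕ} (k : ℕ) (p : ℕ → Fin b → ℤ) : Set (Finset Triangle) :=
  {l | ∃ (x : ℤ) (y : ℕ), .up x y ∈ hexagon k b k ∧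
    ((∃ i, p y i = x ∧ p (y + 1) i = x ∧ l = lozengeR x y) ∨
      (∃ i, p y i = x ∧ p (y + 1) i = x - 1 ∧ l = lozengeL x y) ∨
      ((∀ i, p y i ≠ x) ∧ l = lozengeV x y))}

section OfTiling

variable {k b : ℕ} {T : Set (Finset Triangle)}

theorem stepPosition_spec (hT : IsTiling (hexagon k b k) T) {x : ℤ} {y : ℕ}
    (hx : .up x y ∈ hexagon k b k) (hV : lozengeV x y ∉ T) :
    (lozengeR x y ∈ T ∧ stepPosition T y x = x) ∨
      (lozengeL x y ∈ T ∧ stepPosition T y x = x - 1) := by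
  by_cases hR : lozengeR x y ∈ T
  · exact Or.inl ⟨hR, if_pos hR⟩
  · exact Or.inr ⟨((hT.up_cases hx).resolve_left hV).resolve_left hR, if_neg hR⟩

/-- The downward triangle just traversed already belongs to a lozenge of the path, so the edge above
it is not interior to a vertical lozenge and the path can continue. -/
theorem stepPosition_down_mem (hT : IsTiling (hexagon k b k) T) {x : ℤ} {y : ℕ}
    (hx : .up x y ∈ hexagon k b k) (hV : lozengeV x y ∉ T) :
    .down (stepPosition T y x) y ∈ hexagon k b k ∧ lozengeV (stepPosition T y x) (y + 1 : ℕ) ∉ T := by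
  rcases stepPosition_spec hT hx hV with ⟨h, e⟩ | ⟨h, e⟩
  · rw [e]
    refine ⟨(hT.1 _ h).2 _ (by simp), fun hV' => ?_⟩
    exact lozengeR_ne_lozengeV _ _ _ _
      (hT.eq_of_mem h hV' (t := .down x y) (by simp) (by simp))
  · rw [e]
    refine ⟨(hT.1 _ h).2 _ (by simp), fun hV' => ?_⟩
    exact lozengeL_ne_lozengeV _ _ _ _
      (hT.eq_of_mem h hV' (t := .down (x - 1) y) (by simp) (by simp))

theorem tilingPaths_up_mem (hT : IsTiling (hexagon k b k) T) {y : ℕ} (hy : y < k + k) (i : Fin b) :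
    .up (tilingPaths k b T y i) y ∈ hexagon k b k ∧ lozengeV (tilingPaths k b T y i) y ∉ T := by
  induction y with
  | zero =>
    refine ⟨up_mem_hexagon.mpr ?_, fun h => ?_⟩
    · simp only [tilingPaths]; omega
    -- A vertical lozenge across the bottom side would leave the hexagon.
    · have := down_mem_hexagon.mp ((hT.1 _ h).2 (.down (tilingPaths k b T 0 i) (-1)) (by simp))
      omega
  | succ y ih =>
    obtain ⟨h1, h2⟩ := ih (by omega)
    obtain ⟨h3, h4⟩ := stepPosition_down_mem hT h1 h2
    rw [tilingPaths, if_pos (by omega)]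
    refine ⟨up_mem_hexagon.mpr ?_, h4⟩
    rw [down_mem_hexagon] at h3
    push_cast
    omega

theorem tilingPaths_strictMono (hT : IsTiling (hexagon k b k) T) {y : ℕ} (hy : y ≤ k + k) :
    StrictMono (tilingPaths k b T y) := by
  induction y with
  | zero => exact strictMono_natCast b
  | succ y ih =>
    intro i j hij
    have h := ih (by omega) hij
    obtain ⟨hi, hi'⟩ := tilingPaths_up_mem hT (show y < k + k by omega) i
    obtain ⟨hj, hj'⟩ := tilingPaths_up_mem hT (show y < k + k by omega) j
    rw [tilingPaths, tilingPaths, if_pos (by omega), if_pos (by omega)]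
    rcases stepPosition_spec hT hi hi' with ⟨h1, e1⟩ | ⟨h1, e1⟩ <;>
      rcases stepPosition_spec hT hj hj' with ⟨h2, e2⟩ | ⟨h2, e2⟩ <;> rw [e1, e2]
    · exact h
    -- Two paths can meet only if the left one goes right and the right one goes left; their
    -- lozenges would share a downward triangle.
    · by_contra hc
      refine lozengeR_ne_lozengeL _ _ _ _ (hT.eq_of_mem h1 h2
        (t := .down (tilingPaths k b T y i) y) (by simp) ?_)
      simp only [down_mem_lozengeL, and_true]
      omega
    · omega
    · omega

theorem eq_add_of_strictMono {f : Fin b → ℤ} (hf : StrictMono f) {A : ℤ} (h1 : ∀ i, A ≤ f i)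
    (h2 : ∀ i, f i < A + b) (i : Fin b) : f i = A + i := by
  have lower : ∀ n (hn : n < b), A + n ≤ f ⟨n, hn⟩ := by
    intro n
    induction n with
    | zero => intro hn; simpa using h1 _
    | succ n ih =>
      intro hn
      have := hf (show (⟨n, by omega⟩ : Fin b) < ⟨n + 1, hn⟩ by simp)
      have := ih (by omega)
      push_cast; omega
  have upper : ∀ n (hn : n < b), f ⟨b - 1 - n, by omega⟩ ≤ A + (b - 1 - n) := by
    intro n
    induction n with
    | zero => intro hn; have := h2 ⟨b - 1 - 0, by omega⟩; push_cast; omega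
    | succ n ih =>
      intro hn
      have := hf (show (⟨b - 1 - (n + 1), by omega⟩ : Fin b) < ⟨b - 1 - n, by omega⟩ by
        simp; omega)
      have := ih (by omega)
      push_cast; omega
  have l := lower i i.isLt
  have u := upper (b - 1 - i) (by omega)
  simp only [show b - 1 - (b - 1 - (i : ℕ)) = i by omega] at u
  have : ((b - 1 - (i : ℕ) : ℕ) : ℤ) = b - 1 - i := by omega
  rw [this] at u
  simp only [Fin.eta] at l u
  omega

theorem tilingPaths_of_ge {y : ℕ} (hy : k + k ≤ y) : tilingPaths k b T y = tilingPaths k b T (k + k) := by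
  induction y, hy using Nat.le_induction with
  | base => rfl
  | succ y hy ih =>
    rw [← ih]
    ext i
    rw [tilingPaths, if_neg (by omega)]

/-- At the top side, `b` increasing integers lie in an interval containing only `b` integers, so
they fill it. -/
theorem tilingPaths_end (hT : IsTiling (hexagon k b k) T) (hk : 1 ≤ k) :
    tilingPaths k b T (k + k) = fun i : Fin b => (i : ℤ) - k := by
  have key : ∀ i, .down (tilingPaths k b T (k + k) i) (k + k - 1) ∈ hexagon k b k := by
    intro i
    obtain ⟨h1, h2⟩ := tilingPaths_up_mem hT (show k + k - 1 < k + k by omega) i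
    have h3 := (stepPosition_down_mem hT h1 h2).1
    rw [show k + k = k + k - 1 + 1 by omega, tilingPaths, if_pos (by omega)]
    rwa [show ((k + k - 1 : ℕ) : ℤ) = k + k - 1 by omega] at h3
  simp only [down_mem_hexagon] at key
  ext i
  rw [eq_add_of_strictMono (tilingPaths_strictMono hT le_rfl) (A := -k)
    (fun i => by have := key i; omega) (fun i => by have := key i; omega)]
  ring

theorem tilingPaths_mem_pathFamilies (hT : IsTiling (hexagon k b k) T) (hk : 1 ≤ k) :
    tilingPaths k b T ∈ pathFamilies (fun _ _ => True) (fun i : Fin b => (i : ℤ)) (k + k)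
      fun i => (i : ℤ) - k := by
  refine ⟨rfl, fun y hy i => ?_, fun y hy => tilingPaths_strictMono hT hy, fun _ _ _ => trivial,
    fun y hy => by rw [tilingPaths_of_ge hy, tilingPaths_end hT hk]⟩
  rw [tilingPaths, if_pos hy, stepPosition]
  split_ifs <;> simp

/-- Tracing back downwards: the downward triangle beneath lies in a right or left lozenge, whose
upward triangle is one row lower and again not in a vertical lozenge. In the bottom row every
position is a starting point. -/
theorem exists_tilingPaths_eq (hT : IsTiling (hexagon k b k) T) {x : ℤ} {y : ℕ}
    (hx : .up x y ∈ hexagon k b k) (hV : lozengeV x y ∉ T) : ∃ i, tilingPaths k b T y i = x := by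
  induction y generalizing x with
  | zero =>
    rw [up_mem_hexagon] at hx
    refine ⟨⟨x.toNat, by omega⟩, ?_⟩
    simp only [tilingPaths]; push_cast at hx; omega
  | succ y ih =>
    have hd : .down x y ∈ hexagon k b k := by
      rw [up_mem_hexagon] at hx
      rw [down_mem_hexagon]
      push_cast at hx
      omega
    have hy : y < k + k := by rw [down_mem_hexagon] at hd; omega
    rcases hT.down_cases hd with h | h | h
    · exact (hV (by exact_mod_cast h)).elim
    · obtain ⟨i, hi⟩ := ih ((hT.1 _ h).2 (.up x y) (by simp)) fun h' => lozengeR_ne_lozengeV _ _ _ _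
        (hT.eq_of_mem h h' (t := .up x y) (by simp) (by simp))
      refine ⟨i, ?_⟩
      rw [tilingPaths, if_pos hy, hi, stepPosition, if_pos h]
    · obtain ⟨i, hi⟩ := ih ((hT.1 _ h).2 (.up (x + 1) y) (by simp)) fun h' =>
        lozengeL_ne_lozengeV _ _ _ _ (hT.eq_of_mem h h' (t := .up (x + 1) y) (by simp) (by simp))
      refine ⟨i, ?_⟩
      rw [tilingPaths, if_pos hy, hi, stepPosition, if_neg, add_sub_cancel_right]
      exact fun h' => lozengeR_ne_lozengeL _ _ _ _
        (hT.eq_of_mem h' h (t := .up (x + 1) y) (by simp) (by simp))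

theorem subset_familyTiling (hT : IsTiling (hexagon k b k) T) :
    T ⊆ familyTiling k (tilingPaths k b T) := by
  intro l hl
  obtain ⟨x, y, hxy⟩ := isLozenge_iff.mp (hT.1 l hl).1
  have hu : Triangle.up x y ∈ l := by rcases hxy with rfl | rfl | rfl <;> simp
  have hR := (hT.1 l hl).2 _ hu
  obtain ⟨y, rfl⟩ : ∃ t : ℕ, y = t := ⟨y.toNat, by rw [up_mem_hexagon] at hR; omega⟩
  have hy : y < k + k := by rw [up_mem_hexagon] at hR; omega
  refine ⟨x, y, hR, ?_⟩
  rcases hxy with rfl | rfl | rfl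
  · refine Or.inr (Or.inr ⟨?_, rfl⟩)
    rintro i rfl
    exact (tilingPaths_up_mem hT hy i).2 hl
  · obtain ⟨i, hi⟩ := exists_tilingPaths_eq hT hR fun h' => lozengeR_ne_lozengeV _ _ _ _
      (hT.eq_of_mem hl h' (t := .up x y) (by simp) (by simp))
    refine Or.inl ⟨i, hi, ?_, rfl⟩
    rw [tilingPaths, if_pos hy, hi, stepPosition, if_pos hl]
  · obtain ⟨i, hi⟩ := exists_tilingPaths_eq hT hR fun h' => lozengeL_ne_lozengeV _ _ _ _
      (hT.eq_of_mem hl h' (t := .up x y) (by simp) (by simp))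
    refine Or.inr (Or.inl ⟨i, hi, ?_, rfl⟩)
    rw [tilingPaths, if_pos hy, hi, stepPosition, if_neg]
    exact fun h' => lozengeR_ne_lozengeL _ _ _ _
      (hT.eq_of_mem h' hl (t := .up x y) (by simp) (by simp))

end OfTiling

/-! ### From path families to tilings -/

section OfFamily

variable {k b : ℕ} {p : ℕ → Fin b → ℤ}

theorem pathFamilies_bounds {A : ℕ → ℤ → Prop} {s e : Fin b → ℤ} {m : ℕ}
    (hp : p ∈ pathFamilies A s m e) {y z : ℕ} (hyz : y ≤ z) (hz : z ≤ m) (i : Fin b) :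
    p z i ≤ p y i ∧ p y i ≤ p z i + (z - y) := by
  induction z, hyz using Nat.le_induction with
  | base => simp
  | succ z hyz ih =>
    have := ih (by omega)
    have := hp.2.1 z (by omega) i
    push_cast
    omega

theorem hexagon_bounds (hp : p ∈ pathFamilies (fun _ _ => True) (fun i : Fin b => (i : ℤ)) (k + k)
    fun i => (i : ℤ) - k) {y : ℕ} (hy : y ≤ k + k) (i : Fin b) :
    (i : ℤ) - y ≤ p y i ∧ p y i ≤ i ∧ (i : ℤ) - k ≤ p y i ∧ p y i ≤ i + k - y := by
  have h1 := pathFamilies_bounds hp (Nat.zero_le y) hy i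
  have h2 := pathFamilies_bounds hp hy le_rfl i
  rw [hp.1] at h1
  rw [hp.2.2.2.2 (k + k) le_rfl] at h2
  push_cast at h1 h2
  omega

theorem isTiling_familyTiling (hp : p ∈ pathFamilies (fun _ _ => True) (fun i : Fin b => (i : ℤ))
    (k + k) fun i => (i : ℤ) - k) : IsTiling (hexagon k b k) (familyTiling k p) := by
  have inj : ∀ {y : ℕ}, y ≤ k + k → ∀ {i j}, p y i = p y j → i = j :=
    fun hy _ _ h => (hp.2.2.1 _ hy).injective h
  have start : ∀ {x : ℤ}, .up x (0 : ℕ) ∈ hexagon k b k → ∃ i, p 0 i = x := by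
    intro x hx
    rw [up_mem_hexagon] at hx
    refine ⟨⟨x.toNat, by omega⟩, ?_⟩
    rw [hp.1]; push_cast at hx ⊢; omega
  refine ⟨?_, ?_⟩
  · rintro l ⟨x, y, hx, hl⟩
    have hy : y < k + k := by rw [up_mem_hexagon] at hx; omega
    rcases hl with ⟨i, h1, h2, rfl⟩ | ⟨i, h1, h2, rfl⟩ | ⟨h1, rfl⟩
    · refine ⟨isLozenge_iff.mpr ⟨x, y, by simp⟩, fun t ht => ?_⟩
      simp only [lozengeR, mem_insert, mem_singleton] at ht
      rcases ht with rfl | rfl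
      · exact hx
      · have := hexagon_bounds hp (show y + 1 ≤ k + k by omega) i
        rw [down_mem_hexagon]
        push_cast at this
        omega
    · refine ⟨isLozenge_iff.mpr ⟨x, y, by simp⟩, fun t ht => ?_⟩
      simp only [lozengeL, mem_insert, mem_singleton] at ht
      rcases ht with rfl | rfl
      · exact hx
      · have := hexagon_bounds hp (show y + 1 ≤ k + k by omega) i
        rw [down_mem_hexagon]
        push_cast at this
        omega
    · refine ⟨isLozenge_iff.mpr ⟨x, y, by simp⟩, fun t ht => ?_⟩
      simp only [lozengeV, mem_insert, mem_singleton] at ht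
      rcases ht with rfl | rfl
      · exact hx
      · rcases y with _ | y
        -- The starting points fill the bottom side, so no vertical lozenge is placed there.
        · obtain ⟨i, hi⟩ := start hx
          exact (h1 i hi).elim
        · rw [up_mem_hexagon] at hx
          rw [down_mem_hexagon]
          push_cast at hx ⊢
          omega
  · rintro (⟨x, y⟩ | ⟨x, y⟩) ht
    · obtain ⟨y, rfl⟩ : ∃ t : ℕ, y = t := ⟨y.toNat, by rw [up_mem_hexagon] at ht; omega⟩
      have hy : y < k + k := by rw [up_mem_hexagon] at ht; omega
      by_cases h : ∃ i, p y i = x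
      · obtain ⟨i, hi⟩ := h
        rcases hp.2.1 y hy i with hs | hs <;> rw [hi] at hs
        · refine ⟨lozengeR x y, ⟨⟨x, y, ht, Or.inl ⟨i, hi, hs, rfl⟩⟩, by simp⟩, ?_⟩
          rintro _ ⟨⟨u, v, -, ⟨j, h1, h2, rfl⟩ | ⟨j, h1, h2, rfl⟩ | ⟨h1, rfl⟩⟩, hm⟩ <;>
            simp at hm <;> obtain ⟨rfl, rfl⟩ := hm
          · rfl
          · rw [inj hy.le (h1.trans hi.symm)] at h2; omega
          · exact (h1 i hi).elim
        · refine ⟨lozengeL x y, ⟨⟨x, y, ht, Or.inr (Or.inl ⟨i, hi, hs, rfl⟩)⟩, by simp⟩, ?_⟩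
          rintro _ ⟨⟨u, v, -, ⟨j, h1, h2, rfl⟩ | ⟨j, h1, h2, rfl⟩ | ⟨h1, rfl⟩⟩, hm⟩ <;>
            simp at hm <;> obtain ⟨rfl, rfl⟩ := hm
          · rw [inj hy.le (h1.trans hi.symm)] at h2; omega
          · rfl
          · exact (h1 i hi).elim
      · refine ⟨lozengeV x y, ⟨⟨x, y, ht, Or.inr (Or.inr ⟨not_exists.mp h, rfl⟩)⟩, by simp⟩, ?_⟩
        rintro _ ⟨⟨u, v, -, ⟨j, h1, h2, rfl⟩ | ⟨j, h1, h2, rfl⟩ | ⟨h1, rfl⟩⟩, hm⟩ <;>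
          simp at hm <;> obtain ⟨rfl, rfl⟩ := hm
        · exact (h ⟨j, h1⟩).elim
        · exact (h ⟨j, h1⟩).elim
        · rfl
    · obtain ⟨y, rfl⟩ : ∃ t : ℕ, y = t := ⟨y.toNat, by rw [down_mem_hexagon] at ht; omega⟩
      have hy : y < k + k := by rw [down_mem_hexagon] at ht; omega
      by_cases h : ∃ i, p (y + 1) i = x
      · obtain ⟨i, hi⟩ := h
        have hb := hexagon_bounds hp hy.le i
        have hu : .up (p y i) (y : ℤ) ∈ hexagon k b k := by
          rw [up_mem_hexagon]
          omega
        rcases hp.2.1 y hy i with hs | hs <;> rw [hi] at hs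
        · rw [← hs] at hu
          refine ⟨lozengeR x y, ⟨⟨x, y, hu, Or.inl ⟨i, hs.symm, hi, rfl⟩⟩, by simp⟩, ?_⟩
          rintro _ ⟨⟨u, v, -, ⟨j, h1, h2, rfl⟩ | ⟨j, h1, h2, rfl⟩ | ⟨h1, rfl⟩⟩, hm⟩ <;> simp at hm
          · obtain ⟨rfl, rfl⟩ := hm; rfl
          · obtain ⟨rfl, rfl⟩ := hm
            rw [inj (show y + 1 ≤ k + k by omega) (h2.trans hi.symm)] at h1; omega
          · obtain ⟨rfl, hv⟩ := hm
            obtain rfl : v = y + 1 := by omega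
            exact (h1 i hi).elim
        · rw [show p y i = x + 1 by omega] at hu
          refine ⟨lozengeL (x + 1) y, ⟨⟨x + 1, y, hu, Or.inr (Or.inl ⟨i, by omega, by omega, rfl⟩)⟩,
            by simp⟩, ?_⟩
          rintro _ ⟨⟨u, v, -, ⟨j, h1, h2, rfl⟩ | ⟨j, h1, h2, rfl⟩ | ⟨h1, rfl⟩⟩, hm⟩ <;> simp at hm
          · obtain ⟨rfl, rfl⟩ := hm
            rw [inj (show y + 1 ≤ k + k by omega) (h2.trans hi.symm)] at h1; omega
          · obtain ⟨hu, rfl⟩ := hm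
            obtain rfl : u = x + 1 := by omega
            rfl
          · obtain ⟨rfl, hv⟩ := hm
            obtain rfl : v = y + 1 := by omega
            exact (h1 i hi).elim
      -- The endpoints fill the top side, so a downward triangle missed by the paths has an upward
      -- triangle of the hexagon above it.
      · have hy' : y + 1 < k + k := by
          by_contra hc
          have hyk : y + 1 = k + k := by omega
          rw [down_mem_hexagon] at ht
          refine h ⟨⟨(x + k).toNat, by omega⟩, ?_⟩
          rw [hyk, hp.2.2.2.2 (k + k) le_rfl]
          simp only
          omega
        have hu : .up x ((y + 1 : ℕ) : ℤ) ∈ hexagon k b k := by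
          rw [down_mem_hexagon] at ht
          rw [up_mem_hexagon]
          push_cast
          omega
        refine ⟨lozengeV x (y + 1 : ℕ), ⟨⟨x, y + 1, hu, Or.inr (Or.inr ⟨not_exists.mp h, rfl⟩)⟩,
          by simp⟩, ?_⟩
        rintro _ ⟨⟨u, v, -, ⟨j, h1, h2, rfl⟩ | ⟨j, h1, h2, rfl⟩ | ⟨h1, rfl⟩⟩, hm⟩ <;> simp at hm
        · obtain ⟨rfl, rfl⟩ := hm
          exact (h ⟨j, h2⟩).elim
        · obtain ⟨hu, rfl⟩ := hm
          exact (h ⟨j, by omega⟩).elim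
        · obtain ⟨rfl, hv⟩ := hm
          obtain rfl : v = y + 1 := by omega
          rfl

theorem tilingPaths_familyTiling (hp : p ∈ pathFamilies (fun _ _ => True)
    (fun i : Fin b => (i : ℤ)) (k + k) fun i => (i : ℤ) - k) :
    tilingPaths k b (familyTiling k p) = p := by
  ext y i
  induction y with
  | zero => rw [hp.1]; rfl
  | succ y ih =>
    rw [tilingPaths, ih]
    split_ifs with hy
    · rcases hp.2.1 y hy i with hs | hs
      · have hb := hexagon_bounds hp hy.le i
        rw [stepPosition, if_pos, hs]
        refine ⟨p y i, y, ?_, Or.inl ⟨i, rfl, hs, rfl⟩⟩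
        rw [up_mem_hexagon]
        omega
      · rw [stepPosition, if_neg, hs]
        rintro ⟨u, v, -, ⟨j, h1, h2, h⟩ | ⟨j, h1, h2, h⟩ | ⟨h1, h⟩⟩
        · obtain ⟨rfl, hv⟩ := lozengeR_injective h
          obtain rfl : y = v := by exact_mod_cast hv
          rw [(hp.2.2.1 _ hy.le).injective h1] at h2
          omega
        · exact lozengeR_ne_lozengeL _ _ _ _ h
        · exact lozengeR_ne_lozengeV _ _ _ _ h
    · rw [hp.2.2.2.2 y (by omega), hp.2.2.2.2 (y + 1) (by omega)]

end OfFamily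

theorem bijOn_tilingPaths {k b : ℕ} (hk : 1 ≤ k) :
    Set.BijOn (tilingPaths k b) (hexagonTilings k b k)
      (pathFamilies (fun _ _ => True) (fun i : Fin b => (i : ℤ)) (k + k) fun i => (i : ℤ) - k) := by
  refine ⟨fun T hT => tilingPaths_mem_pathFamilies hT hk, fun T hT T' hT' h => ?_, fun p hp =>
    ⟨familyTiling k p, isTiling_familyTiling hp, tilingPaths_familyTiling hp⟩⟩
  have e : ∀ {T}, IsTiling (hexagon k b k) T → T = familyTiling k (tilingPaths k b T) := fun hT =>
    hT.eq_of_subset (isTiling_familyTiling (tilingPaths_mem_pathFamilies hT hk))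
      (subset_familyTiling hT)
  rw [e hT, e hT', h]

/-! ### The central lozenge -/

theorem Triangle.region_up_subset (x y : ℤ) :
    (Triangle.up x y).region ⊆ {q | (x : ℚ) ≤ q.1 ∧ (y : ℚ) ≤ q.2 ∧ q.1 + q.2 ≤ x + y + 1} := by
  refine convexHull_min ?_ ?_
  · rintro _ ⟨q, hq, rfl⟩
    simp only [Triangle.vertices, coe_insert, coe_singleton, Set.mem_insert_iff,
      Set.mem_singleton_iff] at hq
    rcases hq with rfl | rfl | rfl <;> simp <;> linarith
  · rintro q ⟨h1, h2, h3⟩ r ⟨h4, h5, h6⟩ s t hs ht hst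
    obtain rfl : t = 1 - s := by linarith
    simp only [Set.mem_ofPred_eq, Prod.fst_add, Prod.snd_add, Prod.smul_fst, Prod.smul_snd, smul_eq_mul]
    refine ⟨?_, ?_, ?_⟩ <;> nlinarith

theorem Triangle.region_down_subset (x y : ℤ) :
    (Triangle.down x y).region ⊆
      {q | q.1 ≤ (x : ℚ) + 1 ∧ q.2 ≤ (y : ℚ) + 1 ∧ (x : ℚ) + y + 1 ≤ q.1 + q.2} := by
  refine convexHull_min ?_ ?_
  · rintro _ ⟨q, hq, rfl⟩
    simp only [Triangle.vertices, coe_insert, coe_singleton, Set.mem_insert_iff,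
      Set.mem_singleton_iff] at hq
    rcases hq with rfl | rfl | rfl <;> simp <;> linarith
  · rintro q ⟨h1, h2, h3⟩ r ⟨h4, h5, h6⟩ s t hs ht hst
    obtain rfl : t = 1 - s := by linarith
    simp only [Set.mem_ofPred_eq, Prod.fst_add, Prod.snd_add, Prod.smul_fst, Prod.smul_snd, smul_eq_mul]
    refine ⟨?_, ?_, ?_⟩ <;> nlinarith

theorem midpoint_mem_region {t : Triangle} {x y : ℤ} (h1 : (x, y) ∈ t.vertices)
    (h2 : (x + 1, y) ∈ t.vertices) : ((x : ℚ) + 1 / 2, (y : ℚ)) ∈ t.region := by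
  have m1 : ((x : ℚ), (y : ℚ)) ∈ t.region := subset_convexHull _ _ ⟨(x, y), h1, rfl⟩
  have m2 : ((x : ℚ) + 1, (y : ℚ)) ∈ t.region :=
    subset_convexHull _ _ ⟨(x + 1, y), h2, by simp⟩
  have := (convex_convexHull ℚ _) m1 m2 (show (0 : ℚ) ≤ 1 / 2 by norm_num)
    (show (0 : ℚ) ≤ 1 / 2 by norm_num) (by norm_num)
  have e : ((x : ℚ) + 1 / 2, (y : ℚ)) =
      (1 / 2 : ℚ) • ((x : ℚ), (y : ℚ)) + (1 / 2 : ℚ) • ((x : ℚ) + 1, (y : ℚ)) := by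
    simp only [Prod.smul_mk, Prod.mk_add_mk, smul_eq_mul, Prod.mk.injEq]
    exact ⟨by ring, by ring⟩
  rw [e]
  exact this

theorem centralTriangles_eq {k b : ℕ} {x : ℤ} (hk : 1 ≤ k) (hb : 1 ≤ b) (hx : 2 * x + 1 = b - k) :
    centralTriangles k b k = (lozengeV x k : Set Triangle) := by
  have hc : hexagonCentre k b k = ((x : ℚ) + 1 / 2, ((k : ℤ) : ℚ)) := by
    have : (2 * x + 1 : ℚ) = b - k := by exact_mod_cast hx
    ext
    · simp only [hexagonCentre]; linarith
    · simp only [hexagonCentre]; push_cast; ring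
  ext t
  simp only [centralTriangles, Set.mem_ofPred_eq, hc, lozengeV, coe_insert, coe_singleton,
    Set.mem_insert_iff, Set.mem_singleton_iff]
  constructor
  · rintro ⟨-, ht⟩
    rcases t with ⟨u, v⟩ | ⟨u, v⟩
    · left
      obtain ⟨h1, h2, h3⟩ := Triangle.region_up_subset u v ht
      simp only at h1 h2 h3
      -- The half-integral first coordinate of the centre makes these inequalities strict; over the
      -- integers they leave a single triangle.
      have h1' : u < x + 1 := by exact_mod_cast (show (u : ℚ) < x + 1 by linarith)
      have h2' : v ≤ k := by exact_mod_cast h2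
      have h3' : x + k < u + v + 1 := by exact_mod_cast (show (x + (k : ℤ) : ℚ) < u + v + 1 by linarith)
      rw [Triangle.up.injEq]
      omega
    · right
      obtain ⟨h1, h2, h3⟩ := Triangle.region_down_subset u v ht
      simp only at h1 h2 h3
      have h1' : x < u + 1 := by exact_mod_cast (show (x : ℚ) < u + 1 by linarith)
      have h2' : k ≤ v + 1 := by exact_mod_cast h2
      have h3' : u + v + 1 < x + 1 + k := by
        exact_mod_cast (show (u + v + 1 : ℚ) < x + 1 + (k : ℤ) by linarith)
      rw [Triangle.down.injEq]
      omega
  · rintro (rfl | rfl)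
    · exact ⟨up_mem_hexagon.mpr (by omega), midpoint_mem_region (by simp [Triangle.vertices])
        (by simp [Triangle.vertices])⟩
    · exact ⟨down_mem_hexagon.mpr (by omega), midpoint_mem_region (by simp [Triangle.vertices])
        (by simp [Triangle.vertices])⟩

/-- The upper central triangle lies either in the vertical lozenge or on a path, and never both. -/
theorem mem_centralTilings_iff {k b : ℕ} {x : ℤ} (hk : 1 ≤ k) (hb : 1 ≤ b)
    (hx : 2 * x + 1 = b - k) {T : Set (Finset Triangle)} (hT : T ∈ hexagonTilings k b k) :
    T ∈ centralTilings k b k ↔ ∀ i, tilingPaths k b T k i ≠ x := by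
  have hV : T ∈ centralTilings k b k ↔ lozengeV x k ∈ T := by
    simp only [centralTilings, Set.mem_ofPred_eq, hT, true_and, centralTriangles_eq hk hb hx,
      coe_inj, exists_eq_right]
  rw [hV]
  constructor
  · rintro h i rfl
    exact (tilingPaths_up_mem hT (show k < k + k by omega) i).2 h
  · intro h
    by_contra hc
    obtain ⟨i, hi⟩ := exists_tilingPaths_eq hT (up_mem_hexagon.mpr (by omega)) hc
    exact h i hi

theorem mem_pathFamilies_avoid_iff {b k m : ℕ} (hk : 1 ≤ k) (hkm : k ≤ m) (x : ℤ) (s e : Fin b → ℤ)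
    (p : ℕ → Fin b → ℤ) :
    p ∈ pathFamilies (fun y w => ¬ (y = k ∧ w = x)) s m e ↔
      p ∈ pathFamilies (fun _ _ => True) s m e ∧ ∀ i, p k i ≠ x := by
  constructor
  · rintro ⟨h0, h1, h2, h3, h4⟩
    refine ⟨⟨h0, h1, h2, fun _ _ _ => trivial, h4⟩, fun i hi => ?_⟩
    refine h3 (k - 1) (by omega) i ?_
    rw [show k - 1 + 1 = k by omega]
    exact ⟨rfl, hi⟩
  · rintro ⟨⟨h0, h1, h2, -, h4⟩, h3⟩
    refine ⟨h0, h1, h2, ?_, h4⟩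
    rintro y - i ⟨rfl, h⟩
    exact h3 i h

theorem bijOn_centralTilings {k b : ℕ} {x : ℤ} (hk : 1 ≤ k) (hb : 1 ≤ b)
    (hx : 2 * x + 1 = b - k) :
    Set.BijOn (tilingPaths k b) (centralTilings k b k)
      (pathFamilies (fun y w => ¬ (y = k ∧ w = x)) (fun i : Fin b => (i : ℤ)) (k + k)
        fun i => (i : ℤ) - k) := by
  obtain ⟨h1, h2, h3⟩ := bijOn_tilingPaths (b := b) hk
  refine ⟨fun T hT => ?_, h2.mono fun T hT => hT.1, fun p hp => ?_⟩
  · exact (mem_pathFamilies_avoid_iff hk (by omega) x _ _ _).mpr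
      ⟨h1 hT.1, (mem_centralTilings_iff hk hb hx hT.1).mp hT⟩
  · obtain ⟨hp1, hp2⟩ := (mem_pathFamilies_avoid_iff hk (by omega) x _ _ _).mp hp
    obtain ⟨T, hT, rfl⟩ := h3 hp1
    exact ⟨T, (mem_centralTilings_iff hk hb hx hT).mpr hp2, rfl⟩

theorem ncard_centralTilings_div {k b M : ℕ} (hN : b + k = 2 * M + 1) (hkM : k ≤ M + 1)
    (hk : 1 ≤ k) (hb : 1 ≤ b) :
    ((centralTilings k b k).ncard : ℚ) / (hexagonTilings k b k).ncard = chebKernel M k M := by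
  rw [(bijOn_centralTilings hk hb (show 2 * ((M : ℤ) - k) + 1 = b - k by omega)).ncard_eq,
    (bijOn_tilingPaths hk).ncard_eq, ncard_pathFamilies_avoid hN hkM hk, mul_div_assoc, div_self,
    mul_one]
  rw [Nat.cast_ne_zero, ← Nat.pos_iff_ne_zero,
    Set.ncard_pos (finite_pathFamilies _ (strictMono_natCast b) _ _)]
  exact pathFamilies_hexagon_nonempty b k

end LozengeTilings

theorem mainTheorem1 (n : ℕ) (hn : 1 ≤ n) :
    ((LozengeTilings.centralTilings (2 * n - 1) (2 * n) (2 * n - 1)).ncard : ℚ) /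
        ((LozengeTilings.hexagonTilings (2 * n - 1) (2 * n) (2 * n - 1)).ncard : ℚ) = 1 / 3 ∧
    ((LozengeTilings.centralTilings (2 * n) (2 * n - 1) (2 * n)).ncard : ℚ) /
        ((LozengeTilings.hexagonTilings (2 * n) (2 * n - 1) (2 * n)).ncard : ℚ) = 1 / 3 := by
  constructor
  · rw [LozengeTilings.ncard_centralTilings_div (M := 2 * n - 1) (by omega) (by omega) (by omega)
      (by omega), LozengeTilings.chebKernel_centre hn (Or.inl rfl)]
  · rw [LozengeTilings.ncard_centralTilings_div (M := 2 * n - 1) (by omega) (by omega) (by omega)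
      (by omega), LozengeTilings.chebKernel_centre hn (Or.inr rfl)]
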